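/- Let $\alpha$ be the real root and $\beta$ one of the two non-real roots of $x^3-2x^2-1$ (so $\alpha>1>|\beta|$). Put $\ell_A=\alpha^2-\alpha$, $\ell_B=\alpha$, $\ell_C=1$. Let $\Sigma\mathrm{Kol}(3,1)\subset\mathbb{R}$ be the set of left endpoints of the intervals in the tiling of $\mathbb{R}$ obtained from the bi-infinite fixed point $B|A\mapsto AB|ABC\mapsto ABCAB|ABCABB\mapsto\cdots$ of the substitution $A\mapsto ABC$, $B\mapsto AB$, $C\mapsto B$ by replacing each letter $i$ by an interval of length $\ell_i$, the seam $|$ being at the origin. Let $\Gamma\subset\mathbb{R}\times\mathbb{C}$ be the subgroup generated by $(\alpha^2-\alpha,\beta^2-\beta)$, $(\alpha,\beta)$ and $(1,1)$, and let $L^\star=\mathbb{Z}[\beta]$ be its projection to $\mathbb{C}$. For $W\subset\mathbb{C}$ put $\Lambda(W)=\{x\in\mathbb{R} : (x,z)\in\Gamma \text{ for some } z\in W\}$. Let $\Omega_A,\Omega_B,\Omega_C\subset\mathbb{C}$ be the unique non-empty compact sets with $$\Omega_A=\beta\Omega_A\cup\beta\Omega_B,\qquad \Omega_B=(\beta\Omega_A+\beta^2-\beta)\cup(\beta\Omega_B+\beta^2-\beta)\cup\beta\Omega_C,\qquad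 \Omega_C=\beta\Omega_A+\beta^2,$$ let $\Omega=\Omega_A\cup\Omega_B\cup\Omega_C$, and let $$C=\{c\in\mathbb{C} : (c+(\Omega\setminus(\Omega_A^\circ\cup\Omega_B^\circ\cup\Omega_C^\circ)))\cap L^\star=\varnothing\}.$$ For $\Lambda\subset\mathbb{R}$, $u\in\Lambda$ and $r>0$, the $r$-patch of $\Lambda$ at $u$ is $\Lambda\cap B_r(u)$. Two sets $\Lambda_1,\Lambda_2$ are locally indistinguishable (LI) if for all $r>0$ every $r$-patch of $\Lambda_1$ at a point $u$ is carried by the translation by $v-u$, for some $v\in\Lambda_2$, to the $r$-patch of $\Lambda_2$ at $v$, and vice versa. A set $\Lambda$ is repetitive if for every $r>0$ there is $R>0$ such that every ball of radius $R$ in $\mathbb{R}$ contains a translate (again an $r$-patch of $\Lambda$) of each $r$-patch of $\Lambda$. The set $\Lambda(W)$ is a generic model set if $\Gamma$ is a lattice (a discrete co-compact subgroup) in $\mathbb{R}\times\mathbb{C}$ whose projection to $\mathbb{R}$ is injective and whose projection to $\mathbb{C}$ is dense, $W$ is relatively compact with non-empty interior, $\partial W$ has Lebesgue measure zero, and $L^\star\cap\partial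 W=\varnothing$. Then $C$ is dense in $\mathbb{C}$, and: 1. for every $c\in C$, $\Lambda(c+\Omega)$ is repetitive and a generic model set; 2. for all $c,\tilde c\in C$, $\Lambda(c+\Omega)$ and $\Lambda(\tilde c+\Omega)$ are LI; 3. for every $c\in C$, $\Sigma\mathrm{Kol}(3,1)$ and $\Lambda(c+\Omega)$ are LI. -/

import Mathlib

namespace Kol

open Set MeasureTheory TopologicalSpace
open scoped NNReal ENNReal

/-! ### The substitution and its geometric realization -/

/-- The alphabet `{A, B, C}` (with `A = 33`, `B = 31`, `C = 11` in `Kol(3,1)`). -/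
inductive Letter : Type
  | A | B | C
  deriving DecidableEq

open Letter

instance : Fintype Letter := ⟨{A, B, C}, fun i => by cases i <;> simp⟩

/-- The substitution `A ↦ ABC`, `B ↦ AB`, `C ↦ B`. -/
def subst : Letter → List Letter
  | A => [A, B, C]
  | B => [A, B]
  | C => [B]

/-- The substitution, extended to words by concatenation. -/
def substWord (w : List Letter) : List Letter := w.flatMap subst

/-- `x² - x`, `x`, `1`. For `x = α` these are the natural bond lengths `ℓ_A, ℓ_B, ℓ_C`,
for `x = β` their Galois conjugates. -/
def bond {R : Type*} [CommRing R] (x : R) : Letter → R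
  | A => x ^ 2 - x
  | B => x
  | C => 1

/-- The length of the word `w` in the geometric realization. -/
def wordLength (α : ℝ) (w : List Letter) : ℝ := (w.map (bond α)).sum

/-- The left endpoints of the intervals of type `i` in the geometric realization of the
bi-infinite fixed point `B|A ↦ AB|ABC ↦ ABCAB|ABCABB ↦ ⋯`, the seam `|` being at the origin.
The words `σⁿ(A)` to the right of the seam extend each other to the right, the words `σⁿ(B)` to
its left extend each other to the left. -/
def endpoints (α : ℝ) (i : Letter) : Set ℝ :=
  {x | ∃ (n : ℕ) (u v : List Letter), substWord^[n] [A] = u ++ i :: v ∧ x = wordLength α u} ∪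
  {x | ∃ (n : ℕ) (u v : List Letter), substWord^[n] [B] = u ++ i :: v ∧
    x = -wordLength α (i :: v)}

/-- The point set `ΣKol(3,1)` of all left endpoints. -/
def sigmaKol (α : ℝ) : Set ℝ := ⋃ i, endpoints α i

/-! ### Cut-and-project schemes with physical space `ℝ` and internal space `ℂ` -/

/-- `Γ` is a lattice (a discrete co-compact subgroup) in `ℝ × ℂ`, the projection to physical
space is one-to-one on `Γ`, and the projection of `Γ` to internal space is dense. -/
structure IsCutProjectScheme (Γ : AddSubgroup (ℝ × ℂ)) : Prop where
  discrete : DiscreteTopology Γ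
  cocompact : CompactSpace ((ℝ × ℂ) ⧸ Γ)
  injOn_fst : InjOn Prod.fst (Γ : Set (ℝ × ℂ))
  dense_snd : Dense (Prod.snd '' (Γ : Set (ℝ × ℂ)))

/-- The cut-and-project set `Λ(W) = {π(x) | x ∈ Γ, π_int(x) ∈ W}`. -/
def modelSet (Γ : AddSubgroup (ℝ × ℂ)) (W : Set ℂ) : Set ℝ :=
  {x | ∃ z ∈ W, (x, z) ∈ Γ}

/-- `Λ(W)` is a model set: the window is relatively compact with non-empty interior. -/
structure IsModelSet (Γ : AddSubgroup (ℝ × ℂ)) (W : Set ℂ) : Prop where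
  scheme : IsCutProjectScheme Γ
  relativelyCompact : IsCompact (closure W)
  interior_nonempty : (interior W).Nonempty

/-- `Λ(W)` is a regular model set. -/
structure IsRegularModelSet (Γ : AddSubgroup (ℝ × ℂ)) (W : Set ℂ) : Prop
    extends IsModelSet Γ W where
  volume_frontier : volume (frontier W) = 0

/-- `Λ(W)` is a generic (non-singular) model set. -/
structure IsGenericModelSet (Γ : AddSubgroup (ℝ × ℂ)) (W : Set ℂ) : Prop
    extends IsRegularModelSet Γ W where
  nonsingular : Prod.snd '' (Γ : Set (ℝ × ℂ)) ∩ frontier W = ∅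

/-! ### Patches, local indistinguishability, repetitivity -/

/-- The `r`-patch of `Λ` at `u`. -/
def patch (Λ : Set ℝ) (r u : ℝ) : Set ℝ := Λ ∩ Metric.ball u r

/-- Every patch of `Λ₁` occurs, up to translation, as a patch of `Λ₂`. -/
def PatchesOccur (Λ₁ Λ₂ : Set ℝ) : Prop :=
  ∀ r > 0, ∀ u ∈ Λ₁, ∃ v ∈ Λ₂, patch Λ₂ r v = (fun x => x + (v - u)) '' patch Λ₁ r u

/-- `Λ₁` and `Λ₂` are locally indistinguishable (LI). -/
def LocallyIndistinguishable (Λ₁ Λ₂ : Set ℝ) : Prop :=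
  PatchesOccur Λ₁ Λ₂ ∧ PatchesOccur Λ₂ Λ₁

/-- `Λ` is repetitive: every ball of radius `R(r)` contains a translate of each `r`-patch. -/
def Repetitive (Λ : Set ℝ) : Prop :=
  ∀ r > 0, ∃ R > 0, ∀ y : ℝ, ∀ u ∈ Λ, ∃ v ∈ Λ,
    patch Λ r v = (fun x => x + (v - u)) '' patch Λ r u ∧ patch Λ r v ⊆ Metric.ball y R

/-! ### The lattice and the windows -/

/-- The lattice `Γ = ℤ v_A + ℤ v_B + ℤ v_C` in `ℝ × ℂ`. -/
def lattice (α : ℝ) (β : ℂ) : AddSubgroup (ℝ × ℂ) :=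
  AddSubgroup.closure (range fun i : Letter => (bond α i, bond β i))

/-- `Ω` is a solution in non-empty compact sets of the iterated function system
`Ω_A = β Ω_A ∪ β Ω_B`, `Ω_B = (β Ω_A + β² - β) ∪ (β Ω_B + β² - β) ∪ β Ω_C`,
`Ω_C = β Ω_A + β²` induced by the substitution. -/
structure IsWindowSystem (β : ℂ) (Ω : Letter → Set ℂ) : Prop where
  isCompact : ∀ i, IsCompact (Ω i)
  nonempty : ∀ i, (Ω i).Nonempty
  eq_A : Ω A = (fun z => β * z) '' Ω A ∪ (fun z => β * z) '' Ω B
  eq_B : Ω B = (fun z => β * z + (β ^ 2 - β)) '' Ω A ∪ (fun z => β * z + (β ^ 2 - β)) '' Ω B ∪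
    (fun z => β * z) '' Ω C
  eq_C : Ω C = (fun z => β * z + β ^ 2) '' Ω A

/-- The map `z ↦ β z + t` on non-empty compact sets. -/
noncomputable def affMap (β t : ℂ) (K : NonemptyCompacts ℂ) : NonemptyCompacts ℂ :=
  K.map (fun z => β * z + t) (by fun_prop)

theorem edist_affMap_le (β t : ℂ) (K K' : NonemptyCompacts ℂ) :
    edist (affMap β t K) (affMap β t K') ≤ ‖β‖₊ * edist K K' := by
  have hz : ∀ x y : ℂ, edist (β * x + t) (β * y + t) = ‖β‖₊ * edist x y := by
    intro x y
    rw [edist_add_right, edist_eq_enorm_sub, edist_eq_enorm_sub, ← mul_sub, enorm_mul]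
    rfl
  have key : ∀ K K' : NonemptyCompacts ℂ, ∀ w ∈ (affMap β t K : Set ℂ),
      Metric.infEDist w (affMap β t K' : Set ℂ) ≤ ‖β‖₊ * edist K K' := by
    intro K K' w hw
    obtain ⟨x, hx, rfl⟩ := hw
    obtain ⟨y, hy, hxy⟩ := K'.isCompact.exists_infEDist_eq_edist K'.nonempty x
    refine (Metric.infEDist_le_edist_of_mem (Set.mem_image_of_mem (fun z => β * z + t) hy)).trans ?_
    rw [hz, ← hxy]
    gcongr
    exact Metric.infEDist_le_hausdorffEDist_of_mem hx
  refine Metric.hausdorffEDist_le_of_infEDist (key K K') fun w hw => ?_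
  rw [edist_comm]
  exact key K' K w hw

/-- One step of the iterated function system, on triples of non-empty compact sets. -/
noncomputable def ifsStep (β : ℂ) (K : Letter → NonemptyCompacts ℂ) :
    Letter → NonemptyCompacts ℂ
  | A => affMap β 0 (K A) ⊔ affMap β 0 (K B)
  | B => affMap β (β ^ 2 - β) (K A) ⊔ affMap β (β ^ 2 - β) (K B) ⊔ affMap β 0 (K C)
  | C => affMap β (β ^ 2) (K A)

theorem contracting_ifsStep {β : ℂ} (hβ : ‖β‖ < 1) : ContractingWith ‖β‖₊ (ifsStep β) := by
  refine ⟨by exact_mod_cast hβ, fun K K' => ?_⟩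
  have h1 : ∀ (i : Letter) (t : ℂ),
      edist (affMap β t (K i)) (affMap β t (K' i)) ≤ ‖β‖₊ * edist K K' := fun i t =>
    (edist_affMap_le β t _ _).trans (by gcongr; exact edist_le_pi_edist K K' i)
  have h2 : ∀ {a b a' b' : NonemptyCompacts ℂ} {r : ℝ≥0∞}, edist a a' ≤ r → edist b b' ≤ r →
      edist (a ⊔ b) (a' ⊔ b') ≤ r := fun ha hb =>
    Metric.hausdorffEDist_union_le.trans (max_le ha hb)
  refine edist_pi_le_iff.2 fun i => ?_
  cases i
  · exact h2 (h1 _ _) (h1 _ _)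
  · exact h2 (h2 (h1 _ _) (h1 _ _)) (h1 _ _)
  · exact h1 _ _

theorem isWindowSystem_iff_isFixedPt (β : ℂ) (K : Letter → NonemptyCompacts ℂ) :
    IsWindowSystem β (fun i => (K i : Set ℂ)) ↔ Function.IsFixedPt (ifsStep β) K := by
  have e : ∀ i, (ifsStep β K i : Set ℂ) = K i ↔ ifsStep β K i = K i := fun i =>
    SetLike.coe_set_eq
  constructor
  · intro h
    funext i
    rw [← e]
    cases i
    · simpa [ifsStep, affMap] using h.eq_A.symm
    · simpa [ifsStep, affMap] using h.eq_B.symm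
    · simpa [ifsStep, affMap] using h.eq_C.symm
  · intro h
    have h' : ∀ i, (ifsStep β K i : Set ℂ) = K i := fun i => (e i).2 (congrFun h i)
    refine ⟨fun i => (K i).isCompact, fun i => (K i).nonempty, ?_, ?_, ?_⟩
    · simpa [ifsStep, affMap] using (h' A).symm
    · simpa [ifsStep, affMap] using (h' B).symm
    · simpa [ifsStep, affMap] using (h' C).symm

/-- Hutchinson's theorem for this iterated function system. -/
theorem existsUnique_isWindowSystem {β : ℂ} (hβ : ‖β‖ < 1) : ∃! Ω, IsWindowSystem β Ω := by
  have hc := contracting_ifsStep hβ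
  have : Nonempty (Letter → NonemptyCompacts ℂ) := ⟨fun _ => {0}⟩
  refine ⟨fun i => (hc.fixedPoint (ifsStep β) i : Set ℂ),
    (isWindowSystem_iff_isFixedPt β _).2 hc.fixedPoint_isFixedPt, fun Ω hΩ => ?_⟩
  let K : Letter → NonemptyCompacts ℂ := fun i => ⟨⟨Ω i, hΩ.isCompact i⟩, hΩ.nonempty i⟩
  have hK : K = hc.fixedPoint (ifsStep β) :=
    hc.fixedPoint_unique ((isWindowSystem_iff_isFixedPt β K).1 hΩ)
  funext i
  rw [← hK]
  rfl

/-- A non-real root of `x³ - 2x² - 1` has modulus less than one. -/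
theorem norm_lt_one_of_root {β : ℂ} (h : β ^ 3 - 2 * β ^ 2 - 1 = 0) (him : β.im ≠ 0) :
    ‖β‖ < 1 := by
  obtain ⟨a, b⟩ := β
  have hre := congrArg Complex.re h
  have hi := congrArg Complex.im h
  simp [pow_succ] at hre hi him
  have h1 : 3 * a ^ 2 - b ^ 2 - 4 * a = 0 := by
    apply mul_left_cancel₀ him
    linear_combination hi
  have h2 : -8 * a * (1 - a) ^ 2 = 1 := by
    linear_combination hre + (3 * a - 2) * (-h1)
  have ha : a < 0 := by
    by_contra hcon
    nlinarith [mul_nonneg (not_lt.1 hcon) (sq_nonneg (1 - a))]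
  have h3 : a * a + b * b < 1 := by nlinarith [mul_pos (neg_pos.2 ha) (neg_pos.2 ha)]
  have h4 : ‖(⟨a, b⟩ : ℂ)‖ ^ 2 < 1 := by
    rw [Complex.sq_norm, Complex.normSq_mk]
    exact h3
  nlinarith [norm_nonneg (⟨a, b⟩ : ℂ)]

/-- The windows `Ω_A, Ω_B, Ω_C`: the solution of the iterated function system in non-empty compact
sets. There is exactly one for `‖β‖ < 1`; being written as a union over all solutions, the
definition needs neither a choice nor a proof of `‖β‖ < 1`. -/
def window (β : ℂ) (i : Letter) : Set ℂ :=
  {z | ∃ Ω : Letter → Set ℂ, IsWindowSystem β Ω ∧ z ∈ Ω i}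

theorem window_eq {β : ℂ} (hβ : ‖β‖ < 1) {Ω : Letter → Set ℂ} (hΩ : IsWindowSystem β Ω) :
    window β = Ω := by
  funext i
  ext z
  constructor
  · rintro ⟨Ω', h', hz⟩
    rwa [(existsUnique_isWindowSystem hβ).unique hΩ h']
  · exact fun hz => ⟨Ω, hΩ, hz⟩

theorem isWindowSystem_window {β : ℂ} (hβ : ‖β‖ < 1) : IsWindowSystem β (window β) := by
  obtain ⟨Ω, hΩ, -⟩ := existsUnique_isWindowSystem hβ
  rwa [window_eq hβ hΩ]

/-- `Ω = Ω_A ∪ Ω_B ∪ Ω_C`. -/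
def totalWindow (β : ℂ) : Set ℂ := ⋃ i, window β i

/-- The union of the interiors of `Ω_A`, `Ω_B` and `Ω_C`. -/
def innerWindow (β : ℂ) : Set ℂ := ⋃ i, interior (window β i)

/-- The set `C` of the shifts `c` such that `c + (Ω ∖ (int Ω_A ∪ int Ω_B ∪ int Ω_C))` contains no
point of `L⋆ = π_int(Γ)`. -/
def genericShifts (α : ℝ) (β : ℂ) : Set ℂ :=
  {c | ((fun z => c + z) '' (totalWindow β \ innerWindow β)) ∩
    Prod.snd '' (lattice α β : Set (ℝ × ℂ)) = ∅}

/-- The window `c + Ω`. -/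
def shiftedWindow (β c : ℂ) : Set ℂ := (fun z => c + z) '' totalWindow β

end Kol

/-!
A vector `t` of letter counts has a physical realization in `ℝ` and its Galois conjugate in `ℂ`.
Inflation by the substitution acts on realizations by multiplication with `α` and with `β`, so the
realization in `ℂ` of a left endpoint of type `i` lies in `Ω_i`. Conversely, the equations for the
windows turn a vector realized in `Ω_j` into a predecessor realized in another window. The
predecessors stay in `ℂ` within the bounded windows, while their physical coordinates shrink until
they are bounded as well, so that only finitely many vectors are left; a finite search shows that
every long enough chain of predecessors meets a left endpoint. Hence the left endpoints of type `i`
are exactly the lattice points over `Ω_i`.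

As the tiles cover the line without overlapping, every lattice point over `Ω_i` lies in the interior
of `Ω_i`; thus the shift `0` is generic, and so are all shifts in `L⋆`, which are dense. For a
generic shift, local indistinguishability and repetitivity are those of nonsingular model sets. The
areas of the boundaries satisfy linear inequalities governed by the substitution matrix, whose
eigenvalue `α` equals `‖β‖⁻²`; they are therefore equalities, so that up to null sets `∂Ω_A`
contains its contractions `β ^ n ∂Ω_A`. These shrink to the origin, an interior point of `Ω_A`, so
that `∂Ω_A` is a null set.
-/

namespace Kol

open Set MeasureTheory TopologicalSpace Letter Filter Topology
open scoped NNReal ENNReal Pointwise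

/-! ### Cut-and-project sets -/

section CutAndProject

theorem exists_forall_dist_le_of_cocompact {E : Type*} [SeminormedAddCommGroup E]
    (Γ : AddSubgroup E) [CompactSpace (E ⧸ Γ)] : ∃ R, ∀ p, ∃ γ ∈ Γ, dist p γ ≤ R := by
  obtain ⟨R, hR⟩ := (isCompact_univ (X := E ⧸ Γ)).isBounded.exists_norm_le
  refine ⟨R + 1, fun p => ?_⟩
  have hp : Metric.infDist p Γ < R + 1 := by
    rw [← QuotientAddGroup.norm_mk]
    linarith [hR (p : E ⧸ Γ) (mem_univ _)]
  obtain ⟨γ, hγ, h⟩ := (Metric.infDist_lt_iff ⟨0, Γ.zero_mem⟩).1 hp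
  exact ⟨γ, hγ, h.le⟩

variable {Γ : AddSubgroup (ℝ × ℂ)} {W : Set ℂ}

theorem finite_inter_of_isBounded [DiscreteTopology Γ] {S : Set (ℝ × ℂ)}
    (hS : Bornology.IsBounded S) : (S ∩ (Γ : Set (ℝ × ℂ))).Finite :=
  Metric.finite_isBounded_inter_isClosed (DiscreteTopology.isDiscrete) hS
    (AddSubgroup.isClosed_of_discrete (H := Γ))

/-- Compactness of a large ball in internal space upgrades denseness to denseness with bounded gaps
in physical space. -/
theorem exists_forall_abs_sub_le_of_dense [CompactSpace ((ℝ × ℂ) ⧸ Γ)]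
    (hΓ : Dense (Prod.snd '' (Γ : Set (ℝ × ℂ)))) {V : Set ℂ} (hV : IsOpen V)
    (hne : V.Nonempty) : ∃ R, ∀ y : ℝ, ∃ γ ∈ Γ, γ.2 ∈ V ∧ |γ.1 - y| ≤ R := by
  obtain ⟨R₀, hR₀⟩ := exists_forall_dist_le_of_cocompact Γ
  have hcover : Metric.closedBall (0 : ℂ) R₀ ⊆ ⋃ δ : Γ, {z | z + (δ : ℝ × ℂ).2 ∈ V} := by
    intro z _
    obtain ⟨v, hv⟩ := hne
    obtain ⟨_, hδV, δ, hδ, rfl⟩ := hΓ.inter_open_nonempty {w | z + w ∈ V}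
      (hV.preimage (by fun_prop)) ⟨v - z, by simpa only [mem_ofPred_eq, add_sub_cancel] using hv⟩
    exact mem_iUnion.2 ⟨⟨δ, hδ⟩, hδV⟩
  obtain ⟨F, hF⟩ := (isCompact_closedBall (0 : ℂ) R₀).elim_finite_subcover _
    (fun δ => hV.preimage (by fun_prop)) hcover
  obtain ⟨M, hM⟩ := (F.finite_toSet.image fun δ : Γ => |(δ : ℝ × ℂ).1|).bddAbove
  refine ⟨R₀ + M, fun y => ?_⟩
  obtain ⟨γ, hγ, hyγ⟩ := hR₀ (y, 0)
  rw [Prod.dist_eq, max_le_iff] at hyγ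
  obtain ⟨δ, hδF, hδV⟩ := mem_iUnion₂.1 (hF (Metric.mem_closedBall_comm.1 hyγ.2))
  refine ⟨γ + δ, Γ.add_mem hγ δ.2, hδV, ?_⟩
  have hδM : |(δ : ℝ × ℂ).1| ≤ M := hM (mem_image_of_mem _ hδF)
  have hγy : |γ.1 - y| ≤ R₀ := by rw [← Real.dist_eq, dist_comm]; exact hyγ.1
  calc |(γ + δ).1 - y| = |(γ.1 - y) + (δ : ℝ × ℂ).1| := by rw [Prod.fst_add]; ring_nf
    _ ≤ R₀ + M := (abs_add_le _ _).trans (add_le_add hγy hδM)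

/-- The points of `Γ` over `(-r, r)` that move `z` into `W`. For `(u, z) ∈ Γ` it encodes the
`r`-patch of `Λ(W)` at `u`, recentred at the origin. -/
def pattern (Γ : AddSubgroup (ℝ × ℂ)) (W : Set ℂ) (r : ℝ) (z : ℂ) : Set (ℝ × ℂ) :=
  {γ | γ ∈ Γ ∧ |γ.1| < r ∧ z + γ.2 ∈ W}

theorem zero_mem_pattern {r : ℝ} (hr : 0 < r) {z : ℂ} : 0 ∈ pattern Γ W r z ↔ z ∈ W := by
  simp [pattern, hr]

theorem pattern_translate (c z : ℂ) (r : ℝ) :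
    pattern Γ ((fun w => c + w) '' W) r z = pattern Γ W r (z - c) := by
  ext γ
  simp only [pattern, image_add_left, mem_ofPred_eq, mem_preimage]
  ring_nf

theorem patch_modelSet {r u : ℝ} {z : ℂ} (h : (u, z) ∈ Γ) :
    patch (modelSet Γ W) r u = (fun γ => γ.1 + u) '' pattern Γ W r z := by
  ext x
  constructor
  · rintro ⟨⟨w, hw, hxw⟩, hx⟩
    refine ⟨(x, w) - (u, z), ⟨Γ.sub_mem hxw h, hx, ?_⟩, sub_add_cancel x u⟩
    simpa only [Prod.snd_sub, add_sub_cancel] using hw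
  · rintro ⟨γ, ⟨hγ, hr, hW⟩, rfl⟩
    refine ⟨⟨z + γ.2, hW, ?_⟩, ?_⟩
    · rw [add_comm z]
      exact Γ.add_mem hγ h
    · simpa [Real.dist_eq] using hr

theorem patch_modelSet_eq_translate {W' : Set ℂ} {r u v : ℝ} {z w : ℂ} (hu : (u, z) ∈ Γ)
    (hv : (v, w) ∈ Γ) (h : pattern Γ W' r w = pattern Γ W r z) :
    patch (modelSet Γ W') r v = (fun x => x + (v - u)) '' patch (modelSet Γ W) r u := by
  rw [patch_modelSet hu, patch_modelSet hv, h, image_image]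
  simp only [add_assoc, add_sub_cancel]

theorem eventually_mem_iff_of_notMem_frontier {X : Type*} [TopologicalSpace X] {S : Set X} {x : X}
    (hx : x ∉ frontier S) : ∀ᶠ y in 𝓝 x, (y ∈ S ↔ x ∈ S) := by
  rw [← mem_compl_iff, compl_frontier_eq_union_interior] at hx
  rcases hx with hx | hx
  · filter_upwards [mem_interior_iff_mem_nhds.1 hx] with y hy
    exact iff_of_true hy (interior_subset hx)
  · filter_upwards [mem_interior_iff_mem_nhds.1 hx] with y hy
    exact iff_of_false hy (interior_subset hx)

theorem finite_biUnion_pattern [DiscreteTopology Γ] (hW : Bornology.IsBounded W) (r : ℝ) {K : Set ℂ}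
    (hK : Bornology.IsBounded K) : (⋃ z ∈ K, pattern Γ W r z).Finite := by
  refine (finite_inter_of_isBounded (Γ := Γ)
    ((Metric.isBounded_ball (x := (0 : ℝ)) (r := r)).prod (hW.sub hK))).subset ?_
  refine iUnion₂_subset fun z hz γ ⟨hγ, hr, hzγ⟩ => ⟨⟨?_, ?_⟩, hγ⟩
  · simpa using hr
  · exact ⟨z + γ.2, hzγ, z, hz, add_sub_cancel_left z γ.2⟩

theorem eventually_pattern_subset [DiscreteTopology Γ] (hW : IsCompact W) (r : ℝ) (z : ℂ) :
    ∀ᶠ z' in 𝓝 z, pattern Γ W r z' ⊆ pattern Γ W r z := by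
  have hfin : (⋃ x ∈ Metric.closedBall z 1, pattern Γ W r x).Finite :=
    finite_biUnion_pattern hW.isBounded r Metric.isBounded_closedBall
  have hmem : ∀ᶠ z' in 𝓝 z, ∀ γ ∈ ⋃ x ∈ Metric.closedBall z 1, pattern Γ W r x,
      z' + γ.2 ∈ W → z + γ.2 ∈ W := by
    refine (eventually_all_finite hfin).2 fun γ _ => ?_
    by_cases h : z + γ.2 ∈ W
    · exact Eventually.of_forall fun _ _ => h
    · have hγ : Tendsto (fun z' => z' + γ.2) (𝓝 z) (𝓝 (z + γ.2)) :=
        Continuous.tendsto (by fun_prop) z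
      filter_upwards [hγ.eventually (hW.isClosed.isOpen_compl.mem_nhds h)] with z' hz' hz'W
      exact absurd hz'W hz'
  filter_upwards [hmem, Metric.closedBall_mem_nhds z one_pos] with z' hz' hball γ hγ
  exact ⟨hγ.1, hγ.2.1, hz' γ (mem_biUnion hball hγ) hγ.2.2⟩

theorem eventually_pattern_eq [DiscreteTopology Γ] (hW : Bornology.IsBounded W) (r : ℝ) {z : ℂ}
    (hz : ∀ γ ∈ Γ, z + γ.2 ∉ frontier W) :
    ∀ᶠ z' in 𝓝 z, pattern Γ W r z' = pattern Γ W r z := by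
  have hfin : (⋃ x ∈ Metric.closedBall z 1, pattern Γ W r x).Finite :=
    finite_biUnion_pattern hW r Metric.isBounded_closedBall
  have hmem : ∀ᶠ z' in 𝓝 z, ∀ γ ∈ ⋃ x ∈ Metric.closedBall z 1, pattern Γ W r x,
      (z' + γ.2 ∈ W ↔ z + γ.2 ∈ W) := by
    refine (eventually_all_finite hfin).2 fun γ hγ => ?_
    obtain ⟨x, -, hγx⟩ := mem_iUnion₂.1 hγ
    have hγ' : Tendsto (fun z' => z' + γ.2) (𝓝 z) (𝓝 (z + γ.2)) :=
      Continuous.tendsto (by fun_prop) z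
    exact hγ'.eventually (eventually_mem_iff_of_notMem_frontier (hz γ hγx.1))
  filter_upwards [hmem, Metric.closedBall_mem_nhds z one_pos] with z' hz' hball
  ext γ
  constructor <;> intro hγ
  · exact ⟨hγ.1, hγ.2.1, (hz' γ (mem_biUnion hball hγ)).1 hγ.2.2⟩
  · exact ⟨hγ.1, hγ.2.1,
      (hz' γ (mem_biUnion (Metric.mem_closedBall_self zero_le_one) hγ)).2 hγ.2.2⟩

theorem finite_image_pattern [DiscreteTopology Γ] (hW : Bornology.IsBounded W) (r : ℝ) :
    (pattern Γ W r '' W).Finite := by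
  refine (finite_biUnion_pattern (Γ := Γ) hW r hW).finite_subsets.subset ?_
  rintro _ ⟨z, hz, rfl⟩
  exact subset_biUnion_of_mem (u := pattern Γ W r) hz

theorem add_snd_notMem_frontier (hsing : Prod.snd '' (Γ : Set (ℝ × ℂ)) ∩ frontier W = ∅)
    {u : ℝ} {z : ℂ} (hu : (u, z) ∈ Γ) : ∀ γ ∈ Γ, z + γ.2 ∉ frontier W := fun γ hγ h =>
  eq_empty_iff_forall_notMem.1 hsing _ ⟨⟨(u, z) + γ, Γ.add_mem hu hγ, rfl⟩, h⟩

theorem patchesOccur_modelSet_translate [DiscreteTopology Γ]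
    (hΓ : Dense (Prod.snd '' (Γ : Set (ℝ × ℂ)))) (hW : Bornology.IsBounded W)
    (hsing : Prod.snd '' (Γ : Set (ℝ × ℂ)) ∩ frontier W = ∅) (c : ℂ) :
    PatchesOccur (modelSet Γ W) (modelSet Γ ((fun z => c + z) '' W)) := by
  rintro r hr u ⟨z, hz, hu⟩
  obtain ⟨V, hV, hVo, hzV⟩ := eventually_nhds_iff.1
    (eventually_pattern_eq hW r (add_snd_notMem_frontier hsing hu))
  obtain ⟨w, hwV, ⟨v, w⟩, hv, rfl⟩ := hΓ.inter_open_nonempty {w | w - c ∈ V}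
    (hVo.preimage (by fun_prop)) ⟨z + c, by simpa only [mem_ofPred_eq, add_sub_cancel_right]⟩
  have hpat : pattern Γ ((fun z => c + z) '' W) r w = pattern Γ W r z :=
    (pattern_translate c w r).trans (hV _ hwV)
  refine ⟨v, ⟨w, ?_, hv⟩, patch_modelSet_eq_translate hu hv hpat⟩
  rwa [← zero_mem_pattern (Γ := Γ) hr, hpat, zero_mem_pattern hr]

theorem IsCutProjectScheme.repetitive_modelSet (hΓ : IsCutProjectScheme Γ)
    (hW : Bornology.IsBounded W) (hsing : Prod.snd '' (Γ : Set (ℝ × ℂ)) ∩ frontier W = ∅) :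
    Repetitive (modelSet Γ W) := by
  intro r hr
  have := hΓ.discrete
  have := hΓ.cocompact
  have hgap : ∀ P ∈ pattern Γ W r '' (W ∩ Prod.snd '' (Γ : Set (ℝ × ℂ))),
      ∃ R, ∀ y : ℝ, ∃ γ ∈ Γ, pattern Γ W r γ.2 = P ∧ |γ.1 - y| ≤ R := by
    rintro _ ⟨_, ⟨-, ⟨u, z⟩, hu, rfl⟩, rfl⟩
    obtain ⟨V, hV, hVo, hzV⟩ := eventually_nhds_iff.1
      (eventually_pattern_eq hW r (add_snd_notMem_frontier hsing hu))
    obtain ⟨R, hR⟩ := exists_forall_abs_sub_le_of_dense hΓ.dense_snd hVo ⟨z, hzV⟩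
    refine ⟨R, fun y => ?_⟩
    obtain ⟨γ, hγ, hγV, hγy⟩ := hR y
    exact ⟨γ, hγ, hV _ hγV, hγy⟩
  choose! gap hgap using hgap
  obtain ⟨M, hM⟩ := (((finite_image_pattern (Γ := Γ) hW r).subset
    (image_mono inter_subset_left)).image gap).bddAbove
  refine ⟨|M| + r, by positivity, fun y u ⟨z, hz, hu⟩ => ?_⟩
  have hP := mem_image_of_mem (pattern Γ W r) (show z ∈ W ∩ Prod.snd '' (Γ : Set (ℝ × ℂ)) from
    ⟨hz, (u, z), hu, rfl⟩)
  obtain ⟨⟨v, w⟩, hv, hpat, hvy⟩ := hgap _ hP y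
  refine ⟨v, ⟨w, ?_, hv⟩, patch_modelSet_eq_translate hu hv hpat, fun x hx => ?_⟩
  · rwa [← zero_mem_pattern (Γ := Γ) hr, hpat, zero_mem_pattern hr]
  · have hgapM : gap (pattern Γ W r z) ≤ M := hM (mem_image_of_mem gap hP)
    have hvM : dist v y ≤ |M| := (hvy.trans hgapM).trans (le_abs_self M)
    rw [Metric.mem_ball]
    linarith [dist_triangle x v y, Metric.mem_ball.1 hx.2]

end CutAndProject

/-! ### Parikh vectors -/

/-- The numbers of letters `A`, `B`, `C` of a word, extended to integers so that differences of
positions are covered too. They are the coordinates of the points of the lattice with respect to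
its three generators. -/
abbrev ParikhVector : Type := ℤ × ℤ × ℤ

/-- The Parikh vector of a word. -/
def parikh (w : List Letter) : ParikhVector := (w.count A, w.count B, w.count C)

@[simp] theorem parikh_nil : parikh [] = 0 := rfl

theorem parikh_append (v w : List Letter) : parikh (v ++ w) = parikh v + parikh w := by
  simp only [parikh, List.count_append, Nat.cast_add, Prod.mk_add_mk]

theorem parikh_cons (i : Letter) (w : List Letter) : parikh (i :: w) = parikh [i] + parikh w :=
  parikh_append [i] w

/-- The sum of the bonds at `x` of the letters counted by a Parikh vector: a length for `x = α`,
its star map for `x = β`. -/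
def realize {R : Type*} [CommRing R] (x : R) : ParikhVector →+ R where
  toFun t := t.1 * bond x A + t.2.1 * bond x B + t.2.2 * bond x C
  map_zero' := by simp
  map_add' s t := by simp only [Prod.fst_add, Prod.snd_add, Int.cast_add]; ring

theorem realize_apply {R : Type*} [CommRing R] (x : R) (t : ParikhVector) :
    realize x t = t.1 * (x ^ 2 - x) + t.2.1 * x + t.2.2 * 1 := rfl

theorem realize_parikh_singleton {R : Type*} [CommRing R] (x : R) (i : Letter) :
    realize x (parikh [i]) = bond x i := by
  cases i <;> simp [realize, parikh]

theorem wordLength_eq_realize (α : ℝ) (w : List Letter) :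
    wordLength α w = realize α (parikh w) := by
  induction w with
  | nil => rw [parikh_nil, map_zero]; rfl
  | cons i w ih =>
    rw [parikh_cons, map_add, ← ih, realize_parikh_singleton]
    rfl

/-- The incidence matrix of the substitution. -/
def inflate : ParikhVector ≃+ ParikhVector where
  toFun t := (t.1 + t.2.1, t.1 + t.2.1 + t.2.2, t.1)
  invFun t := (t.2.2, t.1 - t.2.2, t.2.1 - t.1)
  left_inv t := by ext <;> simp
  right_inv t := by ext <;> simp
  map_add' s t := by ext <;> simp only [Prod.fst_add, Prod.snd_add] <;> ring

theorem realize_inflate {R : Type*} [CommRing R] {x : R} (hx : x ^ 3 - 2 * x ^ 2 - 1 = 0)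
    (t : ParikhVector) : realize x (inflate t) = x * realize x t := by
  simp only [realize_apply, inflate, AddEquiv.coe_mk, Equiv.coe_fn_mk, Int.cast_add]
  linear_combination -(t.1 : R) * hx

theorem mul_realize_inflate_symm {R : Type*} [CommRing R] {x : R}
    (hx : x ^ 3 - 2 * x ^ 2 - 1 = 0) (t : ParikhVector) :
    x * realize x (inflate.symm t) = realize x t := by
  rw [← realize_inflate hx, AddEquiv.apply_symm_apply]

theorem realize_iterate_inflate {R : Type*} [CommRing R] {x : R}
    (hx : x ^ 3 - 2 * x ^ 2 - 1 = 0) (n : ℕ) (t : ParikhVector) :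
    realize x (inflate^[n] t) = x ^ n * realize x t := by
  induction n with
  | zero => simp
  | succ n ih => rw [Function.iterate_succ_apply', realize_inflate hx, ih, pow_succ']; ring

theorem substWord_cons (i : Letter) (w : List Letter) :
    substWord (i :: w) = subst i ++ substWord w := rfl

theorem substWord_append (v w : List Letter) :
    substWord (v ++ w) = substWord v ++ substWord w := List.flatMap_append

theorem iterate_substWord_append (n : ℕ) (v w : List Letter) :
    substWord^[n] (v ++ w) = substWord^[n] v ++ substWord^[n] w :=
  Function.Semiconj₂.iterate (fun v w => substWord_append v w) n v w

theorem parikh_substWord (w : List Letter) : parikh (substWord w) = inflate (parikh w) := by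
  induction w with
  | nil => rfl
  | cons i w ih =>
    rw [substWord_cons, parikh_append, parikh_cons, map_add, ih]
    congr 1
    cases i <;> rfl

theorem parikh_iterate_substWord (n : ℕ) (w : List Letter) :
    parikh (substWord^[n] w) = inflate^[n] (parikh w) :=
  Function.Semiconj.iterate_right parikh_substWord n w

/-! ### The roots -/

/-- `α` is the real root and `β` one of the two non-real roots of `x³ - 2x² - 1`. -/
structure IsRootPair (α : ℝ) (β : ℂ) : Prop where
  real_root : α ^ 3 - 2 * α ^ 2 - 1 = 0
  nonreal_root : β ^ 3 - 2 * β ^ 2 - 1 = 0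
  im_ne_zero : β.im ≠ 0

theorem root_mem_Ioo {α : ℝ} (hα : α ^ 3 - 2 * α ^ 2 - 1 = 0) : α ∈ Ioo 2.205 2.206 := by
  have h2 : 2 < α := by
    by_contra! h
    nlinarith [sq_nonneg α, mul_nonneg (sq_nonneg α) (sub_nonneg.2 h)]
  constructor
  · by_contra! h
    nlinarith [mul_nonneg (sq_nonneg α) (sub_nonneg.2 h)]
  · by_contra! h
    nlinarith [mul_nonneg (sq_nonneg α) (sub_nonneg.2 h)]

namespace IsRootPair

variable {α : ℝ} {β : ℂ}

theorem norm_lt_one (h : IsRootPair α β) : ‖β‖ < 1 :=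
  norm_lt_one_of_root h.nonreal_root h.im_ne_zero

theorem ne_zero (h : IsRootPair α β) : β ≠ 0 := fun h0 => h.im_ne_zero (by rw [h0, Complex.zero_im])

/-- Dividing `x³ - 2x² - 1` by `x - α` leaves `x² + (α - 2)x + α² - 2α`, with roots `β` and its
conjugate. -/
theorem re_and_normSq (h : IsRootPair α β) :
    β.re = (2 - α) / 2 ∧ Complex.normSq β = α ^ 2 - 2 * α := by
  have hβα : β - α ≠ 0 := fun h0 =>
    h.im_ne_zero (by rw [sub_eq_zero.1 h0, Complex.ofReal_im])
  have hα : (α : ℂ) ^ 3 - 2 * (α : ℂ) ^ 2 - 1 = 0 := by exact_mod_cast h.real_root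
  have hquad : β ^ 2 + (α - 2) * β + (α ^ 2 - 2 * α) = 0 :=
    mul_left_cancel₀ hβα (by linear_combination h.nonreal_root - hα)
  obtain ⟨hre, him⟩ := Complex.ext_iff.1 hquad
  simp only [pow_two, Complex.add_re, Complex.add_im, Complex.sub_re, Complex.sub_im,
    Complex.mul_re, Complex.mul_im, Complex.ofReal_re, Complex.ofReal_im, Complex.re_ofNat,
    Complex.im_ofNat, Complex.zero_re, Complex.zero_im] at hre him
  have hβre : β.re = (2 - α) / 2 :=
    mul_left_cancel₀ h.im_ne_zero (by linear_combination him / 2)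
  refine ⟨hβre, ?_⟩
  rw [Complex.normSq_apply]
  linear_combination -hre + 2 * β.re * hβre

theorem norm_sq (h : IsRootPair α β) : ‖β‖ ^ 2 = α ^ 2 - 2 * α := by
  rw [Complex.sq_norm, h.re_and_normSq.2]

theorem mul_norm_sq (h : IsRootPair α β) : α * ‖β‖ ^ 2 = 1 := by
  rw [h.norm_sq]
  linear_combination h.real_root

theorem im_sq (h : IsRootPair α β) : β.im ^ 2 = (3 * α ^ 2 - 4 * α - 4) / 4 := by
  obtain ⟨hre, hn⟩ := h.re_and_normSq
  rw [Complex.normSq_apply, hre] at hn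
  linear_combination hn

theorem norm_sub_one_sq (h : IsRootPair α β) : ‖β - 1‖ ^ 2 = α ^ 2 - α - 1 := by
  obtain ⟨hre, hn⟩ := h.re_and_normSq
  rw [Complex.normSq_apply] at hn
  rw [Complex.sq_norm, Complex.normSq_apply, Complex.sub_re, Complex.sub_im, Complex.one_re,
    Complex.one_im]
  linear_combination hn - 2 * hre

theorem norm_sub_real_sq (h : IsRootPair α β) : ‖β - α‖ ^ 2 = 3 * α ^ 2 - 4 * α := by
  obtain ⟨hre, hn⟩ := h.re_and_normSq
  rw [Complex.normSq_apply] at hn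
  rw [Complex.sq_norm, Complex.normSq_apply, Complex.sub_re, Complex.sub_im, Complex.ofReal_re,
    Complex.ofReal_im]
  linear_combination hn - 2 * α * hre

end IsRootPair

/-! ### The coordinates of a lattice point -/

/-- The divided difference at `α` and `β`: it isolates the first coordinate as an imaginary part. -/
theorem realize_sub_realize (α : ℝ) (β : ℂ) (t : ParikhVector) :
    realize β t - realize α t = (β - α) * (t.1 * (β + α - 1) + t.2.1) := by
  simp only [realize_apply]
  push_cast
  ring

theorem abs_fst_mul_le (α : ℝ) (β : ℂ) (t : ParikhVector) :
    |(t.1 : ℝ)| * (|β.im| * ‖β - α‖) ≤ |realize α t| + ‖realize β t‖ := by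
  have him : (t.1 : ℝ) * β.im = ((t.1 : ℂ) * (β + α - 1) + t.2.1).im := by simp
  calc |(t.1 : ℝ)| * (|β.im| * ‖β - α‖)
      = ‖β - α‖ * |((t.1 : ℂ) * (β + α - 1) + t.2.1).im| := by rw [← him, abs_mul]; ring
    _ ≤ ‖β - α‖ * ‖(t.1 : ℂ) * (β + α - 1) + t.2.1‖ := by
        gcongr; exact Complex.abs_im_le_norm _
    _ = ‖realize β t - (realize α t : ℂ)‖ := by rw [realize_sub_realize, norm_mul]
    _ ≤ |realize α t| + ‖realize β t‖ := by
        refine (norm_sub_le _ _).trans_eq ?_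
        rw [Complex.norm_real, Real.norm_eq_abs, add_comm]

theorem IsRootPair.abs_fst_le {α : ℝ} {β : ℂ} (h : IsRootPair α β) (t : ParikhVector) :
    |(t.1 : ℝ)| ≤ 0.63 * (|realize α t| + ‖realize β t‖) := by
  obtain ⟨hl, hu⟩ := root_mem_Ioo h.real_root
  have hlow : 1.59 ≤ |β.im| * ‖β - α‖ := by
    refine le_of_sq_le_sq ?_ (by positivity)
    rw [mul_pow, sq_abs, h.im_sq, h.norm_sub_real_sq]
    have : 5.765 ≤ 3 * α ^ 2 - 4 * α := by nlinarith
    nlinarith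
  have := abs_fst_mul_le α β t
  nlinarith [abs_nonneg (t.1 : ℝ)]

/-! ### The lattice -/

theorem compactSpace_quotient_span_basis {ι E : Type*} [Finite ι] [NormedAddCommGroup E]
    [NormedSpace ℝ E] (b : Module.Basis ι ℝ E) :
    CompactSpace (E ⧸ (Submodule.span ℤ (range b)).toAddSubgroup) := by
  have := Fintype.ofFinite ι
  have := Module.Finite.of_basis b
  have := FiniteDimensional.proper ℝ E
  refine ⟨((isCompact_closedBall (0 : E) (∑ i, ‖b i‖)).image
    continuous_quotient_mk').of_isClosed_subset isClosed_univ fun q _ => ?_⟩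
  obtain ⟨v, rfl⟩ := QuotientAddGroup.mk_surjective q
  refine ⟨ZSpan.fract b v, mem_closedBall_zero_iff.2 (ZSpan.norm_fract_le b v), ?_⟩
  refine QuotientAddGroup.eq.2 ?_
  rw [ZSpan.fract_apply, neg_sub, sub_add_cancel]
  exact (ZSpan.floor b v).2

theorem sum_letter {M : Type*} [AddCommMonoid M] (f : Letter → M) :
    ∑ i, f i = f A + (f B + f C) := by
  change ∑ i ∈ {A, B, C}, f i = _
  rw [Finset.sum_insert (by decide), Finset.sum_pair (by decide)]

theorem linearIndependent_bond (α : ℝ) {β : ℂ} (hβ : β.im ≠ 0) :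
    LinearIndependent ℝ fun i : Letter => (bond α i, bond β i) := by
  refine Fintype.linearIndependent_iff.2 fun g hg => ?_
  rw [sum_letter, Prod.ext_iff] at hg
  obtain ⟨hα0, hβ0⟩ := hg
  have hα0 : g A * (α ^ 2 - α) + (g B * α + g C * 1) = 0 := hα0
  simp only [Prod.smul_mk, Prod.mk_add_mk, bond, Complex.real_smul, Prod.snd_zero] at hβ0
  have hα0' : (g A : ℂ) * (α ^ 2 - α) + (g B * α + g C * 1) = 0 := by exact_mod_cast hα0
  have hβα : β - α ≠ 0 := fun h0 => hβ (by rw [sub_eq_zero.1 h0, Complex.ofReal_im])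
  have hdiv : (g A : ℂ) * (β + α - 1) + g B = 0 :=
    mul_left_cancel₀ hβα (by linear_combination hβ0 - hα0')
  have hA : g A = 0 := by
    have him := congrArg Complex.im hdiv
    simpa [hβ] using him
  have hB : g B = 0 := by simpa [hA] using hdiv
  have hC : g C = 0 := by simpa [hA, hB] using hα0
  rintro (_ | _ | _)
  exacts [hA, hB, hC]

instance : Nonempty Letter := ⟨A⟩

/-- The generators of the lattice, as a basis of the real vector space `ℝ × ℂ`. -/
noncomputable def bondBasis (α : ℝ) {β : ℂ} (hβ : β.im ≠ 0) : Module.Basis Letter ℝ (ℝ × ℂ) :=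
  basisOfLinearIndependentOfCardEqFinrank (linearIndependent_bond α hβ) (by
    rw [Module.finrank_prod, Module.finrank_self, Complex.finrank_real_complex]
    rfl)

theorem lattice_eq_span (α : ℝ) {β : ℂ} (hβ : β.im ≠ 0) :
    lattice α β = (Submodule.span ℤ (range (bondBasis α hβ))).toAddSubgroup := by
  rw [Submodule.span_int_eq_addSubgroupClosure, bondBasis,
    coe_basisOfLinearIndependentOfCardEqFinrank]
  rfl

theorem discreteTopology_lattice (α : ℝ) {β : ℂ} (hβ : β.im ≠ 0) :
    DiscreteTopology (lattice α β) := by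
  rw [lattice_eq_span α hβ]
  infer_instance

theorem compactSpace_quotient_lattice (α : ℝ) {β : ℂ} (hβ : β.im ≠ 0) :
    CompactSpace ((ℝ × ℂ) ⧸ lattice α β) := by
  rw [lattice_eq_span α hβ]
  exact compactSpace_quotient_span_basis _

theorem mem_lattice_iff {α : ℝ} {β : ℂ} {γ : ℝ × ℂ} :
    γ ∈ lattice α β ↔ ∃ t, (realize α t, realize β t) = γ := by
  constructor
  · intro hγ
    have hle : lattice α β ≤ ((realize α).prod (realize β)).range := by
      refine (AddSubgroup.closure_le _).2 ?_
      rintro _ ⟨i, rfl⟩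
      exact ⟨parikh [i], by simp only [AddMonoidHom.prod_apply, realize_parikh_singleton]⟩
    exact hle hγ
  · rintro ⟨t, rfl⟩
    have hbond (i : Letter) : (bond α i, bond β i) ∈ lattice α β :=
      AddSubgroup.subset_closure ⟨i, rfl⟩
    have hsum := add_mem (add_mem (zsmul_mem (hbond A) t.1) (zsmul_mem (hbond B) t.2.1))
      (zsmul_mem (hbond C) t.2.2)
    convert hsum using 1
    simp [realize]

theorem realize_mem_lattice (α : ℝ) (β : ℂ) (t : ParikhVector) :
    (realize α t, realize β t) ∈ lattice α β := mem_lattice_iff.2 ⟨t, rfl⟩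

theorem image_snd_lattice (α : ℝ) (β : ℂ) :
    Prod.snd '' (lattice α β : Set (ℝ × ℂ)) = range (realize β) := by
  ext z
  constructor
  · rintro ⟨_, hγ, rfl⟩
    obtain ⟨t, rfl⟩ := mem_lattice_iff.1 hγ
    exact ⟨t, rfl⟩
  · rintro ⟨t, rfl⟩
    exact ⟨_, realize_mem_lattice α β t, rfl⟩

theorem mem_modelSet_lattice_iff {α : ℝ} {β : ℂ} {W : Set ℂ} {x : ℝ} :
    x ∈ modelSet (lattice α β) W ↔ ∃ t, realize α t = x ∧ realize β t ∈ W := by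
  constructor
  · rintro ⟨z, hz, hxz⟩
    obtain ⟨t, ht⟩ := mem_lattice_iff.1 hxz
    obtain ⟨rfl, rfl⟩ := Prod.mk.inj ht
    exact ⟨t, rfl, hz⟩
  · rintro ⟨t, rfl, ht⟩
    exact ⟨_, ht, realize_mem_lattice α β t⟩

namespace IsRootPair

variable {α : ℝ} {β : ℂ}

theorem mul_mem_lattice (h : IsRootPair α β) {γ : ℝ × ℂ} (hγ : γ ∈ lattice α β) :
    (α * γ.1, β * γ.2) ∈ lattice α β := by
  obtain ⟨t, rfl⟩ := mem_lattice_iff.1 hγ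
  rw [← realize_inflate h.real_root, ← realize_inflate h.nonreal_root]
  exact realize_mem_lattice α β _

theorem pow_mul_mem_lattice (h : IsRootPair α β) (n : ℕ) {γ : ℝ × ℂ} (hγ : γ ∈ lattice α β) :
    (α ^ n * γ.1, β ^ n * γ.2) ∈ lattice α β := by
  induction n with
  | zero => simpa using hγ
  | succ n ih => simpa only [pow_succ', mul_assoc] using h.mul_mem_lattice ih

/-- A lattice point over `0` is contracted by the powers of `β`, which discreteness forbids unless
it is zero. -/
theorem eq_zero_of_fst_eq_zero (h : IsRootPair α β) {z : ℂ} (hz : (0, z) ∈ lattice α β) :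
    z = 0 := by
  have := discreteTopology_lattice α h.im_ne_zero
  have hmem (n : ℕ) : ((0 : ℝ), β ^ n * z) ∈ lattice α β := by
    simpa only [mul_zero] using h.pow_mul_mem_lattice n hz
  have hlim : Tendsto (fun n : ℕ => (⟨(0, β ^ n * z), hmem n⟩ : lattice α β)) atTop (𝓝 0) := by
    refine tendsto_subtype_rng.2 (tendsto_const_nhds.prodMk_nhds ?_)
    simpa only [zero_mul, Prod.snd_zero, ZeroMemClass.coe_zero] using
      (tendsto_pow_atTop_nhds_zero_of_norm_lt_one h.norm_lt_one).mul_const z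
  rw [nhds_discrete, tendsto_pure] at hlim
  obtain ⟨n, hn⟩ := hlim.exists
  have hn' : β ^ n * z = 0 := congrArg (fun γ : lattice α β => (γ : ℝ × ℂ).2) hn
  exact (mul_eq_zero.1 hn').resolve_left (pow_ne_zero n h.ne_zero)

theorem injOn_fst_lattice (h : IsRootPair α β) :
    InjOn Prod.fst (lattice α β : Set (ℝ × ℂ)) := by
  rintro ⟨x, z⟩ hxz ⟨_, z'⟩ hxz' rfl
  refine Prod.ext rfl (sub_eq_zero.1 (h.eq_zero_of_fst_eq_zero ?_))
  simpa only [Prod.mk_sub_mk, sub_self] using (lattice α β).sub_mem hxz hxz'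

theorem dense_snd_lattice (h : IsRootPair α β) :
    Dense (Prod.snd '' (lattice α β : Set (ℝ × ℂ))) := by
  have := compactSpace_quotient_lattice α h.im_ne_zero
  obtain ⟨R, hR⟩ := exists_forall_dist_le_of_cocompact (lattice α β)
  refine Metric.dense_iff.2 fun z ε hε => ?_
  have hlim : Tendsto (fun n : ℕ => ‖β‖ ^ n * R) atTop (𝓝 0) := by
    simpa only [zero_mul] using
      (tendsto_pow_atTop_nhds_zero_of_lt_one (norm_nonneg β) h.norm_lt_one).mul_const R
  obtain ⟨n, hn⟩ := (hlim.eventually_lt_const hε).exists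
  obtain ⟨γ, hγ, hdist⟩ := hR (0, z / β ^ n)
  have hdist' : ‖γ.2 - z / β ^ n‖ ≤ R := by
    rw [← dist_eq_norm, dist_comm]
    exact (le_max_right _ _).trans hdist
  refine ⟨β ^ n * γ.2, ?_, _, h.pow_mul_mem_lattice n hγ, rfl⟩
  have hfactor : β ^ n * γ.2 - z = β ^ n * (γ.2 - z / β ^ n) := by
    rw [mul_sub, mul_div_cancel₀ z (pow_ne_zero n h.ne_zero)]
  calc dist (β ^ n * γ.2) z = ‖β‖ ^ n * ‖γ.2 - z / β ^ n‖ := by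
        rw [dist_eq_norm, hfactor, norm_mul, norm_pow]
    _ ≤ ‖β‖ ^ n * R := by gcongr
    _ < ε := hn

theorem isCutProjectScheme_lattice (h : IsRootPair α β) : IsCutProjectScheme (lattice α β) where
  discrete := discreteTopology_lattice α h.im_ne_zero
  cocompact := compactSpace_quotient_lattice α h.im_ne_zero
  injOn_fst := h.injOn_fst_lattice
  dense_snd := h.dense_snd_lattice

end IsRootPair

/-! ### Tile positions -/

/-- The pairs `(i, d)` such that the inflation of a tile of type `i` contains a tile of type `j`
at distance `d` from its left endpoint. -/
def parents : Letter → List (Letter × ParikhVector)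
  | A => [(A, 0), (B, 0)]
  | B => [(A, parikh [A]), (B, parikh [A]), (C, 0)]
  | C => [(A, parikh [A, B])]

theorem exists_subst_eq_of_mem_parents {i j : Letter} {d : ParikhVector}
    (h : (i, d) ∈ parents j) : ∃ p q, subst i = p ++ j :: q ∧ parikh p = d := by
  have hdec : ∀ j, ∀ e ∈ parents j, ∃ k < 3,
      (subst e.1)[k]? = some j ∧ parikh ((subst e.1).take k) = e.2 := by decide
  obtain ⟨k, -, hk, hd⟩ := hdec j _ h
  obtain ⟨hlt, rfl⟩ := List.getElem?_eq_some_iff.1 hk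
  exact ⟨_, _, by rw [List.cons_getElem_drop_succ, List.take_append_drop], hd⟩

theorem mem_parents_of_subst_eq {i j : Letter} {p q : List Letter} (h : subst i = p ++ j :: q) :
    (i, parikh p) ∈ parents j := by
  have hdec : ∀ i j : Letter, ∀ k : Fin 3, (subst i)[(k : ℕ)]? = some j →
      (i, parikh ((subst i).take k)) ∈ parents j := by decide
  have hlen : ∀ i, (subst i).length ≤ 3 := by decide
  have hlt : p.length < 3 := by
    have := hlen i
    rw [h, List.length_append, List.length_cons] at this
    omega
  have hp := hdec i j ⟨p.length, hlt⟩
  rw [h, List.take_left, List.getElem?_append_right le_rfl, Nat.sub_self] at hp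
  exact hp rfl

theorem exists_of_substWord_eq {w u v : List Letter} {j : Letter}
    (h : substWord w = u ++ j :: v) :
    ∃ u' i v' p q, w = u' ++ i :: v' ∧ subst i = p ++ j :: q ∧ u = substWord u' ++ p := by
  induction w generalizing u with
  | nil => simp [substWord] at h
  | cons a w ih =>
    rw [substWord_cons, List.append_eq_append_iff] at h
    rcases h with ⟨u₁, rfl, h⟩ | ⟨_ | ⟨b, q⟩, hq, h⟩
    · obtain ⟨u', i, v', p, q, rfl, hi, rfl⟩ := ih h
      exact ⟨a :: u', i, v', p, q, rfl, hi, by rw [substWord_cons, List.append_assoc]⟩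
    · obtain ⟨u', i, v', p, q, rfl, hi, h'⟩ := ih (u := []) h.symm
      refine ⟨a :: u', i, v', p, q, rfl, hi, ?_⟩
      rw [substWord_cons, List.append_assoc, ← h', hq, List.append_nil, List.append_nil]
    · obtain ⟨rfl, rfl⟩ := List.cons.inj h
      exact ⟨[], a, w, u, q, rfl, hq, rfl⟩

/-- The Parikh vectors whose realizations are the left endpoints of the tiles of type `i`, read off
from the words `σⁿ(B)|σⁿ(A)` with the seam at the origin. -/
def positions (i : Letter) : Set ParikhVector :=
  {t | ∃ (n : ℕ) (u v : List Letter), substWord^[n] [B, A] = u ++ i :: v ∧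
    t = parikh u - parikh (substWord^[n] [B])}

theorem endpoints_eq_image (α : ℝ) (i : Letter) :
    endpoints α i = realize α '' positions i := by
  have hsplit (n : ℕ) : substWord^[n] [B, A] = substWord^[n] [B] ++ substWord^[n] [A] :=
    iterate_substWord_append n [B] [A]
  ext x
  constructor
  · rintro (⟨n, u, v, h, rfl⟩ | ⟨n, u, v, h, rfl⟩)
    · refine ⟨parikh u, ⟨n, substWord^[n] [B] ++ u, v, ?_, ?_⟩,
        (wordLength_eq_realize α u).symm⟩
      · rw [hsplit, h, List.append_assoc]
      · rw [parikh_append, add_sub_cancel_left]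
    · refine ⟨-parikh (i :: v), ⟨n, u, v ++ substWord^[n] [A], ?_, ?_⟩, ?_⟩
      · rw [hsplit, h, List.append_assoc, List.cons_append]
      · rw [h, parikh_append, sub_add_cancel_left]
      · rw [map_neg, wordLength_eq_realize]
  · rintro ⟨_, ⟨n, u, v, h, rfl⟩, rfl⟩
    rw [hsplit, List.append_eq_append_iff] at h
    rcases h with ⟨u', rfl, h⟩ | ⟨_ | ⟨a, q⟩, hq, h⟩
    · exact Or.inl ⟨n, u', v, h, by
        rw [parikh_append, add_sub_cancel_left, wordLength_eq_realize]⟩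
    · refine Or.inl ⟨n, [], v, h.symm, ?_⟩
      rw [hq, List.append_nil, sub_self, wordLength_eq_realize, parikh_nil]
    · obtain ⟨rfl, rfl⟩ := List.cons.inj h
      refine Or.inr ⟨n, u, q, hq, ?_⟩
      rw [hq, parikh_append, sub_add_cancel_left, map_neg, wordLength_eq_realize]

theorem zero_mem_positions_A : 0 ∈ positions A := ⟨0, [B], [], rfl, rfl⟩

theorem neg_parikh_B_mem_positions_B : -parikh [B] ∈ positions B := ⟨0, [], [A], rfl, rfl⟩

theorem inflate_add_mem_positions {i j : Letter} {d t : ParikhVector} (h : (i, d) ∈ parents j)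
    (ht : t ∈ positions i) : inflate t + d ∈ positions j := by
  obtain ⟨n, u, v, hw, rfl⟩ := ht
  obtain ⟨p, q, hs, rfl⟩ := exists_subst_eq_of_mem_parents h
  refine ⟨n + 1, substWord u ++ p, q ++ substWord v, ?_, ?_⟩
  · rw [Function.iterate_succ_apply', hw, substWord_append, substWord_cons, hs]
    simp only [List.append_assoc, List.cons_append]
  · rw [Function.iterate_succ_apply', parikh_append, parikh_substWord, parikh_substWord, map_sub]
    abel

theorem positions_induction {P : Letter → ParikhVector → Prop} (hA : P A 0)
    (hB : P B (-parikh [B]))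
    (hP : ∀ i j d t, (i, d) ∈ parents j → P i t → P j (inflate t + d))
    {j : Letter} {t : ParikhVector} (ht : t ∈ positions j) : P j t := by
  obtain ⟨n, u, v, h, rfl⟩ := ht
  induction n generalizing j u v with
  | zero =>
    rcases List.cons_eq_append_iff.1 h with ⟨rfl, h'⟩ | ⟨u', rfl, h'⟩
    · obtain ⟨rfl, -⟩ := List.cons.inj h'
      exact hB
    · obtain ⟨rfl, hj⟩ | ⟨u'', -, hj⟩ := List.cons_eq_append_iff.1 h'
      · obtain ⟨rfl, -⟩ := List.cons.inj hj
        exact hA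
      · simp at hj
  | succ n ih =>
    rw [Function.iterate_succ_apply'] at h
    obtain ⟨u', i, v', p, q, hw, hs, rfl⟩ := exists_of_substWord_eq h
    convert hP i j _ _ (mem_parents_of_subst_eq hs) (ih u' v' hw) using 1
    rw [Function.iterate_succ_apply', parikh_append, parikh_substWord, parikh_substWord, map_sub]
    abel

theorem exists_iterate_eq_append {n m : ℕ} (h : n ≤ m) :
    ∃ p q, substWord^[m] [B, A] = p ++ substWord^[n] [B, A] ++ q ∧
      parikh p = parikh (substWord^[m] [B]) - parikh (substWord^[n] [B]) := by
  induction m, h using Nat.le_induction with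
  | base => exact ⟨[], [], by simp, by simp⟩
  | succ m _ ih =>
    obtain ⟨p, q, hw, hp⟩ := ih
    have hBA : substWord [B, A] = [A] ++ [B, A] ++ [B, C] := rfl
    have hB : substWord [B] = [A] ++ [B] := rfl
    refine ⟨substWord^[m] [A] ++ p, q ++ substWord^[m] [B, C], ?_, ?_⟩
    · rw [Function.iterate_succ_apply, hBA, iterate_substWord_append, iterate_substWord_append, hw]
      simp only [List.append_assoc]
    · rw [Function.iterate_succ_apply, hB, iterate_substWord_append, parikh_append,
        parikh_append, hp]
      abel

theorem exists_common_word {i j : Letter} {s t : ParikhVector} (hs : s ∈ positions i)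
    (ht : t ∈ positions j) : ∃ (w u v u' v' : List Letter) (o : ParikhVector),
      w = u ++ i :: v ∧ w = u' ++ j :: v' ∧ s = parikh u - o ∧ t = parikh u' - o := by
  have hextend {n m : ℕ} (hnm : n ≤ m) {k : Letter} {u v : List Letter}
      (h : substWord^[n] [B, A] = u ++ k :: v) : ∃ u' v', substWord^[m] [B, A] = u' ++ k :: v' ∧
        parikh u - parikh (substWord^[n] [B]) = parikh u' - parikh (substWord^[m] [B]) := by
    obtain ⟨p, q, hw, hp⟩ := exists_iterate_eq_append hnm
    refine ⟨p ++ u, v ++ q, by simp only [hw, h, List.append_assoc, List.cons_append], ?_⟩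
    rw [parikh_append, hp]
    abel
  obtain ⟨n, u, v, h, rfl⟩ := hs
  obtain ⟨m, u', v', h', rfl⟩ := ht
  obtain ⟨u₁, v₁, h₁, e₁⟩ := hextend (le_max_left n m) h
  obtain ⟨u₂, v₂, h₂, e₂⟩ := hextend (le_max_right n m) h'
  exact ⟨_, u₁, v₁, u₂, v₂, _, h₁, h₂, e₁, e₂⟩

/-! ### The tiles partition the line -/

section Tiles

variable {α : ℝ}

theorem wordLength_append (v w : List Letter) :
    wordLength α (v ++ w) = wordLength α v + wordLength α w := by
  rw [wordLength, List.map_append, List.sum_append]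
  rfl

theorem wordLength_cons (i : Letter) (w : List Letter) :
    wordLength α (i :: w) = bond α i + wordLength α w := List.sum_cons

theorem bond_pos (hα : 1 < α) (i : Letter) : 0 < bond α i := by
  cases i <;> simp only [bond] <;> nlinarith

theorem bond_lt_sq (hα : 1 < α) (i : Letter) : bond α i < α ^ 2 := by
  cases i <;> simp only [bond] <;> nlinarith

theorem wordLength_le_of_prefix (hα : 1 < α) {v w : List Letter} (h : v <+: w) :
    wordLength α v ≤ wordLength α w := by
  obtain ⟨q, rfl⟩ := h
  rw [wordLength_append, le_add_iff_nonneg_right]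
  refine List.sum_nonneg fun x hx => ?_
  obtain ⟨i, -, rfl⟩ := List.mem_map.1 hx
  exact (bond_pos hα i).le

theorem wordLength_add_bond_le (hα : 1 < α) {u v u' v' : List Letter} {i j : Letter}
    (h : u ++ i :: v = u' ++ j :: v') (hlt : u.length < u'.length) :
    wordLength α u + bond α i ≤ wordLength α u' := by
  have hpre : u ++ [i] <+: u' := by
    refine List.prefix_of_prefix_length_le (l₃ := u ++ i :: v) ⟨v, by simp⟩ ⟨j :: v', h.symm⟩ ?_
    rw [List.length_append, List.length_singleton]
    exact hlt
  have hle := wordLength_le_of_prefix hα hpre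
  rwa [wordLength_append, wordLength_cons, show wordLength α [] = 0 from rfl, add_zero] at hle

theorem tile_unique (hα : 1 < α) {i j : Letter} {s t : ParikhVector} (hs : s ∈ positions i)
    (ht : t ∈ positions j) (hst : realize α s ≤ realize α t)
    (hts : realize α t < realize α s + bond α i) : s = t ∧ i = j := by
  obtain ⟨w, u, v, u', v', o, rfl, hw, rfl, rfl⟩ := exists_common_word hs ht
  rw [map_sub, map_sub, ← wordLength_eq_realize, ← wordLength_eq_realize] at hst hts
  rcases lt_trichotomy u.length u'.length with hlt | heq | hlt
  · linarith [wordLength_add_bond_le hα hw hlt]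
  · obtain ⟨rfl, h⟩ := List.append_inj hw heq
    exact ⟨rfl, (List.cons.inj h).1⟩
  · linarith [wordLength_add_bond_le hα hw.symm hlt, bond_pos hα j]

theorem exists_tile_of_lt_wordLength (w : List Letter) {y : ℝ} (h0 : 0 ≤ y)
    (hy : y < wordLength α w) : ∃ u i v, w = u ++ i :: v ∧ wordLength α u ≤ y ∧
      y < wordLength α u + bond α i := by
  induction w generalizing y with
  | nil => exact absurd hy h0.not_gt
  | cons a w ih =>
    rw [wordLength_cons] at hy
    by_cases h : y < bond α a
    · exact ⟨[], a, w, rfl, h0, by rwa [show wordLength α [] = 0 from rfl, zero_add]⟩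
    · obtain ⟨u, i, v, rfl, h1, h2⟩ := ih (y := y - bond α a) (by linarith) (by linarith)
      refine ⟨a :: u, i, v, rfl, ?_, ?_⟩ <;> rw [wordLength_cons] <;> linarith

theorem wordLength_iterate_substWord (hα : α ^ 3 - 2 * α ^ 2 - 1 = 0) (n : ℕ) (w : List Letter) :
    wordLength α (substWord^[n] w) = α ^ n * wordLength α w := by
  rw [wordLength_eq_realize, parikh_iterate_substWord, realize_iterate_inflate hα,
    wordLength_eq_realize]

theorem exists_tile (hα : α ^ 3 - 2 * α ^ 2 - 1 = 0) (y : ℝ) :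
    ∃ i, ∃ t ∈ positions i, realize α t ≤ y ∧ y < realize α t + bond α i := by
  have h2 : 2.205 < α := (root_mem_Ioo hα).1
  obtain ⟨n, hn⟩ := pow_unbounded_of_one_lt |y| (by linarith : 1 < α)
  have hB : wordLength α (substWord^[n] [B]) = α ^ n * α := by
    rw [wordLength_iterate_substWord hα]
    simp [wordLength, bond]
  have hBA : wordLength α (substWord^[n] [B, A]) = α ^ n * α ^ 2 := by
    rw [wordLength_iterate_substWord hα]
    simp [wordLength, bond]
  have hpow : 0 < α ^ n := by positivity
  obtain ⟨u, i, v, hw, hle, hlt⟩ := exists_tile_of_lt_wordLength (α := α)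
    (substWord^[n] [B, A]) (y := y + α ^ n * α)
    (by nlinarith [neg_abs_le y]) (by rw [hBA]; nlinarith [le_abs_self y])
  refine ⟨i, _, ⟨n, u, v, hw, rfl⟩, ?_⟩
  rw [map_sub, ← wordLength_eq_realize, ← wordLength_eq_realize, hB]
  constructor <;> linarith

end Tiles

/-! ### The windows -/

theorem eq_of_mem_parents {i j : Letter} {d : ParikhVector} (h : (i, d) ∈ parents j) :
    d = 0 ∨ d = parikh [A] ∨ d = parikh [A, B] := by
  have hdec : ∀ j, ∀ e ∈ parents j, e.2 = 0 ∨ e.2 = parikh [A] ∨ e.2 = parikh [A, B] := by decide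
  exact hdec j _ h

theorem realize_parikh_AB {R : Type*} [CommRing R] (x : R) : realize x (parikh [A, B]) = x ^ 2 := by
  rw [parikh_cons, map_add, realize_parikh_singleton, realize_parikh_singleton]
  exact sub_add_cancel _ _

section Windows

variable {β : ℂ}

theorem window_eq_biUnion_parents (hβ : ‖β‖ < 1) (j : Letter) :
    window β j = ⋃ e ∈ parents j, (fun z => β * z + realize β e.2) '' window β e.1 := by
  have h := isWindowSystem_window hβ
  have hA : realize β (parikh [A]) = β ^ 2 - β := realize_parikh_singleton β A
  cases j
  · refine h.eq_A.trans ?_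
    simp only [parents, List.mem_cons, List.not_mem_nil, or_false, iUnion_iUnion_eq_or_left,
      iUnion_iUnion_eq_left, map_zero, add_zero]
  · refine h.eq_B.trans ?_
    simp only [parents, List.mem_cons, List.not_mem_nil, or_false, iUnion_iUnion_eq_or_left,
      iUnion_iUnion_eq_left, map_zero, add_zero, hA, union_assoc]
  · refine h.eq_C.trans ?_
    simp only [parents, List.mem_cons, List.not_mem_nil, or_false, iUnion_iUnion_eq_left,
      realize_parikh_AB]

theorem mem_window_iff (hβ : ‖β‖ < 1) {j : Letter} {z : ℂ} :
    z ∈ window β j ↔ ∃ i d, (i, d) ∈ parents j ∧ ∃ z' ∈ window β i, β * z' + realize β d = z := by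
  rw [window_eq_biUnion_parents hβ]
  simp only [mem_iUnion, mem_image, exists_prop, Prod.exists]

theorem isCompact_window (hβ : ‖β‖ < 1) (i : Letter) : IsCompact (window β i) :=
  (isWindowSystem_window hβ).isCompact i

theorem isCompact_totalWindow (hβ : ‖β‖ < 1) : IsCompact (totalWindow β) :=
  isCompact_iUnion (isCompact_window hβ)

theorem fixedPoint_mem_window (hβ : ‖β‖ < 1) {i : Letter} {d : ParikhVector}
    (h : (i, d) ∈ parents i) {z : ℂ} (hz : β * z + realize β d = z) : z ∈ window β i := by
  obtain ⟨w, hw⟩ := (isWindowSystem_window hβ).nonempty i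
  have hmem (n : ℕ) : β ^ n * (w - z) + z ∈ window β i := by
    induction n with
    | zero => rwa [pow_zero, one_mul, sub_add_cancel]
    | succ n ih =>
      refine (mem_window_iff hβ).2 ⟨i, d, h, _, ih, ?_⟩
      linear_combination hz
  have hlim : Tendsto (fun n : ℕ => β ^ n * (w - z) + z) atTop (𝓝 (0 * (w - z) + z)) :=
    ((tendsto_pow_atTop_nhds_zero_of_norm_lt_one hβ).mul_const _).add_const _
  rw [zero_mul, zero_add] at hlim
  exact (isCompact_window hβ i).isClosed.mem_of_tendsto hlim (Eventually.of_forall hmem)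

theorem realize_mem_window (hβ : ‖β‖ < 1) (hroot : β ^ 3 - 2 * β ^ 2 - 1 = 0) {i : Letter}
    {t : ParikhVector} (ht : t ∈ positions i) : realize β t ∈ window β i := by
  refine positions_induction (P := fun i t => realize β t ∈ window β i) ?_ ?_ ?_ ht
  · exact fixedPoint_mem_window hβ (d := 0) (by decide) (by simp)
  · refine fixedPoint_mem_window hβ (d := parikh [A]) (by decide) ?_
    rw [map_neg, realize_parikh_singleton, realize_parikh_singleton]
    simp only [bond]
    ring
  · intro i j d t hid ht
    rw [map_add, realize_inflate hroot]
    exact (mem_window_iff hβ).2 ⟨i, d, hid, _, ht, rfl⟩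

theorem one_sub_norm_mul_norm_le_of_mem_window (hβ : ‖β‖ < 1) {M : ℝ}
    (hM : ∀ i j d, (i, d) ∈ parents j → ‖realize β d‖ ≤ M) {i : Letter} {z : ℂ}
    (hz : z ∈ window β i) : (1 - ‖β‖) * ‖z‖ ≤ M := by
  obtain ⟨w, hw, hmax⟩ := (isCompact_totalWindow hβ).exists_isMaxOn ⟨z, mem_iUnion.2 ⟨i, hz⟩⟩
    continuous_norm.continuousOn
  obtain ⟨j, hj⟩ := mem_iUnion.1 hw
  obtain ⟨k, d, hkd, w', hw', rfl⟩ := (mem_window_iff hβ).1 hj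
  have hw'_le : ‖w'‖ ≤ ‖β * w' + realize β d‖ := hmax (mem_iUnion.2 ⟨k, hw'⟩)
  have hz_le : ‖z‖ ≤ ‖β * w' + realize β d‖ := hmax (mem_iUnion.2 ⟨i, hz⟩)
  have hself : ‖β * w' + realize β d‖ ≤ ‖β‖ * ‖β * w' + realize β d‖ + M := by
    calc ‖β * w' + realize β d‖ ≤ ‖β‖ * ‖w'‖ + ‖realize β d‖ := by
          rw [← norm_mul]; exact norm_add_le _ _
      _ ≤ ‖β‖ * ‖β * w' + realize β d‖ + M :=
        add_le_add (mul_le_mul_of_nonneg_left hw'_le (norm_nonneg β)) (hM k j d hkd)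
  calc (1 - ‖β‖) * ‖z‖ ≤ (1 - ‖β‖) * ‖β * w' + realize β d‖ :=
        mul_le_mul_of_nonneg_left hz_le (sub_nonneg.2 hβ.le)
    _ ≤ M := by rw [sub_mul]; linarith

end Windows

namespace IsRootPair

variable {α : ℝ} {β : ℂ}

theorem norm_lt (h : IsRootPair α β) : ‖β‖ < 0.675 := by
  have := (root_mem_Ioo h.real_root).2
  nlinarith [norm_nonneg β, h.norm_sq, (root_mem_Ioo h.real_root).1]

theorem norm_realize_le_of_mem_parents (h : IsRootPair α β) {i j : Letter} {d : ParikhVector}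
    (hd : (i, d) ∈ parents j) : ‖realize β d‖ ≤ 0.876 := by
  have hβ := h.norm_lt
  rcases eq_of_mem_parents hd with rfl | rfl | rfl
  · rw [map_zero, norm_zero]
    norm_num
  · have hβ1 : ‖β - 1‖ ≤ 1.297 := by
      refine le_of_sq_le_sq ?_ (by norm_num)
      rw [h.norm_sub_one_sq]
      nlinarith [(root_mem_Ioo h.real_root).1, (root_mem_Ioo h.real_root).2]
    calc ‖realize β (parikh [A])‖ = ‖β‖ * ‖β - 1‖ := by
          rw [realize_parikh_singleton, ← norm_mul]; congr 1; simp only [bond]; ring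
      _ ≤ 0.675 * 1.297 := by gcongr
      _ ≤ 0.876 := by norm_num
  · rw [realize_parikh_AB, norm_pow]
    nlinarith [norm_nonneg β]

theorem norm_le_of_mem_window (h : IsRootPair α β) {i : Letter} {z : ℂ} (hz : z ∈ window β i) :
    ‖z‖ ≤ 2.7 := by
  have := one_sub_norm_mul_norm_le_of_mem_window h.norm_lt_one
    (fun _ _ _ hd => h.norm_realize_le_of_mem_parents hd) hz
  nlinarith [norm_nonneg z, h.norm_lt]

end IsRootPair

/-! ### Lattice points in the windows are tile positions -/

/-- Bounds on the coordinates of the lattice points that lie over a window and near the origin of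
the line; the middle one concerns the first coordinate after two deflations. -/
def IsSmall (t : ParikhVector) : Prop := |t.1| ≤ 4 ∧ |t.2.1 - t.1| ≤ 4 ∧ |t.2.2| ≤ 3

instance : DecidablePred IsSmall := fun t =>
  inferInstanceAs (Decidable (|t.1| ≤ 4 ∧ |t.2.1 - t.1| ≤ 4 ∧ |t.2.2| ≤ 3))

/-- The pair `(j, t)` is the end of a chain of `n` small pairs, each inflating to the next, none of
which is one of the two tiles adjacent to the seam. -/
def HasAncestors : ℕ → Letter → ParikhVector → Prop
  | 0, _, _ => True
  | n + 1, j, t => IsSmall t ∧ (j, t) ≠ (A, 0) ∧ (j, t) ≠ (B, -parikh [B]) ∧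
      ∃ e ∈ parents j, HasAncestors n e.1 (inflate.symm (t - e.2))

instance decidableHasAncestors : ∀ n j t, Decidable (HasAncestors n j t)
  | 0, _, _ => inferInstanceAs (Decidable True)
  | n + 1, j, t =>
    have := decidableHasAncestors n
    inferInstanceAs (Decidable (IsSmall t ∧ (j, t) ≠ (A, 0) ∧ (j, t) ≠ (B, -parikh [B]) ∧
      ∃ e ∈ parents j, HasAncestors n e.1 (inflate.symm (t - e.2))))

theorem not_hasAncestors (j : Letter) (t : ParikhVector) : ¬ HasAncestors 12 j t := by
  have hdec : ∀ a ∈ Finset.Icc (-4 : ℤ) 4, ∀ b ∈ Finset.Icc (-4 : ℤ) 4,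
      ∀ c ∈ Finset.Icc (-3 : ℤ) 3, ∀ j, ¬ HasAncestors 12 j (a, a + b, c) := by
    decide +kernel
  intro h
  obtain ⟨ha, hb, hc⟩ := h.1
  refine hdec t.1 (Finset.mem_Icc.2 (abs_le.1 ha)) (t.2.1 - t.1) (Finset.mem_Icc.2 (abs_le.1 hb))
    t.2.2 (Finset.mem_Icc.2 (abs_le.1 hc)) j ?_
  rwa [add_sub_cancel]

namespace IsRootPair

variable {α : ℝ} {β : ℂ}

theorem abs_realize_inflate_symm_le (h : IsRootPair α β) (t : ParikhVector) :
    2.2 * |realize α (inflate.symm t)| ≤ |realize α t| := by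
  have hα := (root_mem_Ioo h.real_root).1
  rw [← mul_realize_inflate_symm h.real_root t, abs_mul, abs_of_pos (by linarith : 0 < α)]
  gcongr
  linarith

theorem norm_realize_inflate_symm_le (h : IsRootPair α β) (t : ParikhVector) :
    0.67 * ‖realize β (inflate.symm t)‖ ≤ ‖realize β t‖ := by
  have hβ : 0.67 ≤ ‖β‖ := by
    refine le_of_sq_le_sq ?_ (norm_nonneg β)
    rw [h.norm_sq]
    nlinarith [(root_mem_Ioo h.real_root).1]
  rw [← mul_realize_inflate_symm h.nonreal_root t, norm_mul]
  gcongr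

theorem isSmall (h : IsRootPair α β) {t : ParikhVector} (hx : |realize α t| ≤ 5)
    (hz : ‖realize β t‖ ≤ 2.7) : IsSmall t := by
  have hx₁ := h.abs_realize_inflate_symm_le t
  have hx₂ := h.abs_realize_inflate_symm_le (inflate.symm t)
  have hz₁ := h.norm_realize_inflate_symm_le t
  have hz₂ := h.norm_realize_inflate_symm_le (inflate.symm t)
  have habs {k n : ℤ} (hk : |(k : ℝ)| < n + 1) : |k| ≤ n :=
    Int.lt_add_one_iff.1 (by exact_mod_cast hk)
  refine ⟨habs ((h.abs_fst_le t).trans_lt ?_),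
    habs ((h.abs_fst_le (inflate.symm (inflate.symm t))).trans_lt ?_),
    habs ((h.abs_fst_le (inflate.symm t)).trans_lt ?_)⟩ <;> push_cast <;> linarith

theorem abs_realize_le_of_mem_parents (h : IsRootPair α β) {i j : Letter} {d : ParikhVector}
    (hd : (i, d) ∈ parents j) : |realize α d| ≤ 4.87 := by
  obtain ⟨hl, hu⟩ := root_mem_Ioo h.real_root
  rw [abs_le]
  rcases eq_of_mem_parents hd with rfl | rfl | rfl
  · rw [map_zero]
    norm_num
  · rw [realize_parikh_singleton]
    constructor <;> simp only [bond] <;> nlinarith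
  · rw [realize_parikh_AB]
    constructor <;> nlinarith

theorem abs_realize_parent_le (h : IsRootPair α β) {i j : Letter} {d : ParikhVector}
    (hd : (i, d) ∈ parents j) (t : ParikhVector) :
    2.2 * |realize α (inflate.symm (t - d))| ≤ |realize α t| + 4.87 := by
  calc 2.2 * |realize α (inflate.symm (t - d))| ≤ |realize α (t - d)| :=
        h.abs_realize_inflate_symm_le _
    _ ≤ |realize α t| + |realize α d| := by rw [map_sub]; exact abs_sub _ _
    _ ≤ |realize α t| + 4.87 := by gcongr; exact h.abs_realize_le_of_mem_parents hd

theorem exists_parent_of_realize_mem_window (h : IsRootPair α β) {j : Letter} {t : ParikhVector}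
    (ht : realize β t ∈ window β j) (hpos : t ∉ positions j) : ∃ i d, (i, d) ∈ parents j ∧
      realize β (inflate.symm (t - d)) ∈ window β i ∧ inflate.symm (t - d) ∉ positions i := by
  obtain ⟨i, d, hid, z, hz, hzt⟩ := (mem_window_iff h.norm_lt_one).1 ht
  refine ⟨i, d, hid, ?_, fun hmem => hpos ?_⟩
  · convert hz
    refine mul_left_cancel₀ h.ne_zero ?_
    rw [mul_realize_inflate_symm h.nonreal_root, map_sub, ← hzt, add_sub_cancel_right]
  · have hinfl := inflate_add_mem_positions hid hmem
    rwa [AddEquiv.apply_symm_apply, sub_add_cancel] at hinfl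

theorem hasAncestors (h : IsRootPair α β) (n : ℕ) {j : Letter} {t : ParikhVector}
    (ht : realize β t ∈ window β j) (hpos : t ∉ positions j) (hx : |realize α t| ≤ 5) :
    HasAncestors n j t := by
  induction n generalizing j t with
  | zero => trivial
  | succ n ih =>
    obtain ⟨i, d, hid, hwin, hpos'⟩ := h.exists_parent_of_realize_mem_window ht hpos
    refine ⟨h.isSmall hx (h.norm_le_of_mem_window ht), ?_, ?_, (i, d), hid,
      ih hwin hpos' (by linarith [h.abs_realize_parent_le hid t])⟩ <;> rintro ⟨⟩
    · exact hpos zero_mem_positions_A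
    · exact hpos neg_parikh_B_mem_positions_B

theorem mem_positions_of_realize_mem_window (h : IsRootPair α β) {j : Letter} {t : ParikhVector}
    (ht : realize β t ∈ window β j) : t ∈ positions j := by
  obtain ⟨N, hN⟩ := exists_nat_ge |realize α t|
  replace hN : |realize α t| ≤ N + 5 := by linarith
  by_contra hpos
  induction N generalizing j t with
  | zero =>
    rw [Nat.cast_zero, zero_add] at hN
    exact not_hasAncestors j t (h.hasAncestors 12 ht hpos hN)
  | succ N ih =>
    obtain ⟨i, d, hid, hwin, hpos'⟩ := h.exists_parent_of_realize_mem_window ht hpos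
    refine ih hwin ?_ hpos'
    have hle := h.abs_realize_parent_le hid t
    push_cast at hN
    linarith [N.cast_nonneg (α := ℝ)]

theorem realize_mem_window_iff (h : IsRootPair α β) {j : Letter} {t : ParikhVector} :
    realize β t ∈ window β j ↔ t ∈ positions j :=
  ⟨h.mem_positions_of_realize_mem_window, realize_mem_window h.norm_lt_one h.nonreal_root⟩

/-- If `realize β y` is close to `realize β t`, the displacement `s` of `y` inside its tile also
carries the window of that tile to `realize β t`, hence `t - s` is a left endpoint whose tile
contains `t`. Tiles do not overlap, so `s = 0` and `y` is itself a left endpoint. -/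
theorem realize_mem_interior_window (h : IsRootPair α β) {i : Letter} {t : ParikhVector}
    (ht : realize β t ∈ window β i) : realize β t ∈ interior (window β i) := by
  have hα : 1 < α := by linarith [(root_mem_Ioo h.real_root).1]
  have := discreteTopology_lattice α h.im_ne_zero
  have hclosed := (isCompact_window h.norm_lt_one i).isClosed
  obtain ⟨V, hV, hVo, htV⟩ := eventually_nhds_iff.1 (eventually_all.2 fun j =>
    eventually_pattern_subset (Γ := lattice α β) (isCompact_window h.norm_lt_one j) (α ^ 2)
      (realize β t))
  have hdense : Dense (range (realize β)) := image_snd_lattice α β ▸ h.dense_snd_lattice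
  refine mem_interior.2 ⟨V, (hdense.open_subset_closure_inter hVo).trans
    (closure_minimal ?_ hclosed), hVo, htV⟩
  rintro _ ⟨hyV, y, rfl⟩
  obtain ⟨j, l, hl, hly, hyl⟩ := exists_tile h.real_root (realize α y)
  have hpattern : (realize α (l - y), realize β (l - y)) ∈
      pattern (lattice α β) (window β j) (α ^ 2) (realize β y) := by
    refine ⟨realize_mem_lattice α β _, ?_, ?_⟩
    · rw [map_sub, abs_sub_comm, abs_of_nonneg (by linarith)]
      linarith [bond_lt_sq hα j]
    · rw [← map_add, add_sub_cancel, h.realize_mem_window_iff]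
      exact hl
  have hs : t + (l - y) ∈ positions j := by
    rw [← h.realize_mem_window_iff, map_add]
    exact (hV _ hyV j hpattern).2.2
  obtain ⟨hst, rfl⟩ := tile_unique hα hs (h.realize_mem_window_iff.1 ht)
    (by rw [map_add, map_sub]; linarith) (by rw [map_add, map_sub]; linarith)
  rw [add_eq_left, sub_eq_zero] at hst
  rwa [← hst, h.realize_mem_window_iff]

theorem zero_mem_interior_window_A (h : IsRootPair α β) : 0 ∈ interior (window β A) := by
  simpa only [map_zero] using
    h.realize_mem_interior_window (h.realize_mem_window_iff.2 zero_mem_positions_A)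

end IsRootPair

/-! ### Generic shifts -/

theorem mem_genericShifts_iff {α : ℝ} {β c : ℂ} :
    c ∈ genericShifts α β ↔ ∀ t, realize β t - c ∉ totalWindow β \ innerWindow β := by
  rw [genericShifts, mem_ofPred_eq, image_snd_lattice, image_add_left,
    eq_empty_iff_forall_notMem]
  simp only [mem_inter_iff, mem_preimage, neg_add_eq_sub, not_and', forall_mem_range]

theorem add_realize_mem_genericShifts {α : ℝ} {β c : ℂ} (hc : c ∈ genericShifts α β)
    (t : ParikhVector) : c + realize β t ∈ genericShifts α β := by
  refine mem_genericShifts_iff.2 fun s => ?_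
  rw [add_comm, ← sub_sub, ← map_sub]
  exact mem_genericShifts_iff.1 hc (s - t)

theorem shiftedWindow_eq_image_shiftedWindow (β c c' : ℂ) :
    shiftedWindow β c' = (fun z => c' - c + z) '' shiftedWindow β c := by
  rw [shiftedWindow, shiftedWindow, image_image]
  simp only [← add_assoc, sub_add_cancel]

theorem frontier_shiftedWindow (β c : ℂ) :
    frontier (shiftedWindow β c) = (fun z => c + z) '' frontier (totalWindow β) :=
  ((Homeomorph.addLeft c).image_frontier _).symm

theorem innerWindow_subset_interior_totalWindow (β : ℂ) :
    innerWindow β ⊆ interior (totalWindow β) :=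
  iUnion_subset fun i => interior_mono (subset_iUnion (window β) i)

theorem isCompact_shiftedWindow {β : ℂ} (hβ : ‖β‖ < 1) (c : ℂ) : IsCompact (shiftedWindow β c) :=
  (isCompact_totalWindow hβ).image (continuous_const.add continuous_id)

theorem image_snd_lattice_inter_frontier_shiftedWindow {α : ℝ} {β c : ℂ} (hβ : ‖β‖ < 1)
    (hc : c ∈ genericShifts α β) :
    Prod.snd '' (lattice α β : Set (ℝ × ℂ)) ∩ frontier (shiftedWindow β c) = ∅ := by
  rw [image_snd_lattice, frontier_shiftedWindow, eq_empty_iff_forall_notMem]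
  rintro _ ⟨⟨t, rfl⟩, z, hz, hzt⟩
  refine mem_genericShifts_iff.1 hc t ?_
  rw [← hzt, add_sub_cancel_left]
  exact ⟨(isCompact_totalWindow hβ).isClosed.frontier_subset hz,
    fun hz' => hz.2 (innerWindow_subset_interior_totalWindow β hz')⟩

namespace IsRootPair

variable {α : ℝ} {β : ℂ}

theorem zero_mem_genericShifts (h : IsRootPair α β) : 0 ∈ genericShifts α β := by
  refine mem_genericShifts_iff.2 fun t ⟨ht, ht'⟩ => ht' ?_
  rw [sub_zero] at ht ⊢
  obtain ⟨i, hi⟩ := mem_iUnion.1 ht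
  exact mem_iUnion.2 ⟨i, h.realize_mem_interior_window hi⟩

theorem dense_genericShifts (h : IsRootPair α β) : Dense (genericShifts α β) := by
  refine h.dense_snd_lattice.mono ?_
  rw [image_snd_lattice]
  rintro _ ⟨t, rfl⟩
  simpa only [zero_add] using add_realize_mem_genericShifts h.zero_mem_genericShifts t

theorem sigmaKol_eq_modelSet (h : IsRootPair α β) :
    sigmaKol α = modelSet (lattice α β) (shiftedWindow β 0) := by
  ext x
  simp only [sigmaKol, endpoints_eq_image, mem_modelSet_lattice_iff, shiftedWindow, zero_add,
    image_id', totalWindow, mem_iUnion, h.realize_mem_window_iff, mem_image]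
  tauto

theorem patchesOccur (h : IsRootPair α β) {c : ℂ} (hc : c ∈ genericShifts α β) (c' : ℂ) :
    PatchesOccur (modelSet (lattice α β) (shiftedWindow β c))
      (modelSet (lattice α β) (shiftedWindow β c')) := by
  have := discreteTopology_lattice α h.im_ne_zero
  rw [shiftedWindow_eq_image_shiftedWindow β c c']
  exact patchesOccur_modelSet_translate h.dense_snd_lattice
    (isCompact_shiftedWindow h.norm_lt_one c).isBounded
    (image_snd_lattice_inter_frontier_shiftedWindow h.norm_lt_one hc) (c' - c)

theorem repetitive (h : IsRootPair α β) {c : ℂ} (hc : c ∈ genericShifts α β) :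
    Repetitive (modelSet (lattice α β) (shiftedWindow β c)) :=
  h.isCutProjectScheme_lattice.repetitive_modelSet
    (isCompact_shiftedWindow h.norm_lt_one c).isBounded
    (image_snd_lattice_inter_frontier_shiftedWindow h.norm_lt_one hc)

end IsRootPair

/-! ### The boundaries of the windows are null sets -/

theorem frontier_biUnion_subset {ι X : Type*} [TopologicalSpace X] {s : Set ι} (hs : s.Finite)
    (f : ι → Set X) : frontier (⋃ i ∈ s, f i) ⊆ ⋃ i ∈ s, frontier (f i) := by
  rintro x ⟨hx, hx'⟩
  rw [hs.closure_biUnion] at hx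
  obtain ⟨i, hi, hxi⟩ := mem_iUnion₂.1 hx
  exact mem_biUnion hi ⟨hxi, fun h => hx' (interior_mono (subset_biUnion_of_mem hi) h)⟩

theorem volume_smul_complex (β : ℂ) (S : Set ℂ) :
    volume (β • S) = ENNReal.ofReal (‖β‖ ^ 2) * volume S := by
  have hdet : LinearMap.det (LinearMap.mul ℝ ℂ β) = ‖β‖ ^ 2 := by
    rw [← Complex.normSq_eq_norm_sq, ← Algebra.norm_complex_apply, Algebra.norm_apply]
    rfl
  refine (Measure.addHaar_image_linearMap volume (LinearMap.mul ℝ ℂ β) S).trans ?_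
  rw [hdet, abs_of_nonneg (sq_nonneg _)]

theorem volumeReal_image_affine (β t : ℂ) (S : Set ℂ) :
    volume.real ((fun z => β * z + t) '' S) = ‖β‖ ^ 2 * volume.real S := by
  have himage : (fun z => β * z + t) '' S = (fun z => z + t) '' (β • S) :=
    (image_image (fun z => z + t) (fun z => β * z) S).symm
  rw [measureReal_def, himage, image_add_right, measure_preimage_add_right, volume_smul_complex,
    ENNReal.toReal_mul, ENNReal.toReal_ofReal (sq_nonneg _), measureReal_def]

theorem frontier_image_affine {β : ℂ} (hβ : β ≠ 0) (t : ℂ) (S : Set ℂ) :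
    frontier ((fun z => β * z + t) '' S) = (fun z => β * z + t) '' frontier S :=
  (((Homeomorph.mulLeft₀ β hβ).trans (Homeomorph.addRight t)).image_frontier S).symm

/-- Up to null sets, `S` contains all its contractions `β ^ n • S`; as these shrink to the origin,
they eventually miss `S`. -/
theorem volume_eq_zero_of_smul_sdiff_null {β : ℂ} (hβ0 : β ≠ 0) (hβ : ‖β‖ < 1) {S : Set ℂ}
    (hS : Bornology.IsBounded S) (h0 : Sᶜ ∈ 𝓝 0) (hnull : volume (β • S \ S) = 0) :
    volume S = 0 := by
  have hiter (n : ℕ) : volume (β ^ n • S \ S) = 0 := by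
    induction n with
    | zero => rw [pow_zero, one_smul, sdiff_self, measure_empty]
    | succ n ih =>
      refine measure_mono_null (t := β • (β ^ n • S \ S) ∪ β • S \ S) ?_
        (measure_union_null (by rw [volume_smul_complex, ih, mul_zero]) hnull)
      rw [pow_succ', mul_smul, smul_set_sdiff₀ hβ0]
      exact sdiff_triangle _ _ _
  have hlim : Tendsto (fun n : ℕ => β ^ n • S) atTop (𝓝 0).smallSets :=
    ((NormedSpace.isVonNBounded_iff ℂ).2 hS).tendsto_smallSets_nhds.comp
      (tendsto_pow_atTop_nhds_zero_of_norm_lt_one hβ)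
  obtain ⟨n, hn⟩ := (hlim.eventually (eventually_smallSets_subset.2 h0)).exists
  have hvol := hiter n
  rw [sdiff_eq_left.2 (disjoint_left.2 fun _ hz => hn hz), volume_smul_complex] at hvol
  refine (mul_eq_zero.1 hvol).resolve_left ?_
  have : 0 < ‖β ^ n‖ := norm_pos_iff.2 (pow_ne_zero n hβ0)
  exact (ENNReal.ofReal_pos.2 (by positivity)).ne'

theorem isCompact_frontier_window {β : ℂ} (hβ : ‖β‖ < 1) (j : Letter) :
    IsCompact (frontier (window β j)) :=
  (isCompact_window hβ j).of_isClosed_subset isClosed_frontier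
    (isCompact_window hβ j).isClosed.frontier_subset

theorem frontier_window_subset {β : ℂ} (hβ0 : β ≠ 0) (hβ : ‖β‖ < 1) (j : Letter) :
    frontier (window β j) ⊆
      ⋃ e ∈ parents j, (fun z => β * z + realize β e.2) '' frontier (window β e.1) := by
  simp only [← frontier_image_affine hβ0]
  conv_lhs => rw [window_eq_biUnion_parents hβ]
  exact frontier_biUnion_subset (parents j).finite_toSet _

theorem isCompact_biUnion_parents_frontier {β : ℂ} (hβ : ‖β‖ < 1) (j : Letter) :
    IsCompact (⋃ e ∈ parents j,
      (fun z => β * z + realize β e.2) '' frontier (window β e.1)) :=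
  (parents j).finite_toSet.isCompact_biUnion fun e _ =>
    (isCompact_frontier_window hβ e.1).image (by fun_prop)

theorem volumeReal_biUnion_parents_frontier_le (β : ℂ) (j : Letter) :
    volume.real (⋃ e ∈ parents j,
      (fun z => β * z + realize β e.2) '' frontier (window β e.1)) ≤
      ‖β‖ ^ 2 * ∑ e ∈ (parents j).toFinset, volume.real (frontier (window β e.1)) := by
  have h := measureReal_biUnion_finset_le (μ := volume) (parents j).toFinset
    fun e => (fun z => β * z + realize β e.2) '' frontier (window β e.1)
  simpa only [List.mem_toFinset, volumeReal_image_affine, Finset.mul_sum] using h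

/-- The bond lengths form a left eigenvector of the substitution matrix. -/
theorem sum_bond_mul_sum_parents {x : ℝ} (hx : x ^ 3 - 2 * x ^ 2 - 1 = 0) (m : Letter → ℝ) :
    ∑ j, bond x j * ∑ e ∈ (parents j).toFinset, m e.1 = x * ∑ i, bond x i * m i := by
  have hA : ∑ e ∈ (parents A).toFinset, m e.1 = m A + m B := by
    change ∑ e ∈ {(A, 0), (B, 0)}, m e.1 = _
    rw [Finset.sum_pair (by decide)]
  have hB : ∑ e ∈ (parents B).toFinset, m e.1 = m A + (m B + m C) := by
    change ∑ e ∈ {(A, parikh [A]), (B, parikh [A]), (C, 0)}, m e.1 = _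
    rw [Finset.sum_insert (by decide), Finset.sum_pair (by decide)]
  have hC : ∑ e ∈ (parents C).toFinset, m e.1 = m A := Finset.sum_singleton _ _
  rw [sum_letter, sum_letter, hA, hB, hC]
  simp only [bond]
  linear_combination -m A * hx

namespace IsRootPair

variable {α : ℝ} {β : ℂ}

/-- Multiplication by `β` scales areas by `‖β‖ ^ 2 = α⁻¹`, the inverse of the eigenvalue in
`sum_bond_mul_sum_parents`: weighted by the bond lengths, the three inequalities add up to an
equality. -/
theorem volumeReal_frontier_window (h : IsRootPair α β) (j : Letter) :
    volume.real (frontier (window β j)) =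
      ‖β‖ ^ 2 * ∑ e ∈ (parents j).toFinset, volume.real (frontier (window β e.1)) := by
  have hα : 1 < α := by linarith [(root_mem_Ioo h.real_root).1]
  have hle (j : Letter) : volume.real (frontier (window β j)) ≤
      ‖β‖ ^ 2 * ∑ e ∈ (parents j).toFinset, volume.real (frontier (window β e.1)) :=
    (measureReal_mono (frontier_window_subset h.ne_zero h.norm_lt_one j)
      (isCompact_biUnion_parents_frontier h.norm_lt_one j).measure_ne_top).trans
      (volumeReal_biUnion_parents_frontier_le β j)
  have hsum : ∑ j, bond α j * volume.real (frontier (window β j)) = ∑ j, bond α j *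
      (‖β‖ ^ 2 * ∑ e ∈ (parents j).toFinset, volume.real (frontier (window β e.1))) := by
    simp only [mul_left_comm (bond α _), ← Finset.mul_sum]
    rw [sum_bond_mul_sum_parents h.real_root fun i => volume.real (frontier (window β i)),
      ← mul_assoc, mul_comm (‖β‖ ^ 2), h.mul_norm_sq, one_mul]
  have heq := (Finset.sum_eq_sum_iff_of_le fun j _ =>
    mul_le_mul_of_nonneg_left (hle j) (bond_pos hα j).le).1 hsum j (Finset.mem_univ j)
  exact mul_left_cancel₀ (bond_pos hα j).ne' heq

theorem volume_image_frontier_sdiff (h : IsRootPair α β) {i j : Letter} {d : ParikhVector}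
    (hd : (i, d) ∈ parents j) :
    volume ((fun z => β * z + realize β d) '' frontier (window β i) \ frontier (window β j))
      = 0 := by
  have hfin := (isCompact_biUnion_parents_frontier h.norm_lt_one j).measure_ne_top (μ := volume)
  have hge := (volumeReal_biUnion_parents_frontier_le β j).trans_eq
    (h.volumeReal_frontier_window j).symm
  rw [measureReal_def, measureReal_def, ENNReal.toReal_le_toReal hfin
    (isCompact_frontier_window h.norm_lt_one j).measure_ne_top] at hge
  have hae := ae_eq_of_subset_of_measure_ge (frontier_window_subset h.ne_zero h.norm_lt_one j)
    hge isClosed_frontier.nullMeasurableSet hfin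
  exact measure_mono_null (sdiff_subset_sdiff_left fun z hz => mem_iUnion₂.2 ⟨(i, d), hd, hz⟩)
    (ae_le_set.1 hae.symm.le)

theorem volume_frontier_window_A (h : IsRootPair α β) : volume (frontier (window β A)) = 0 := by
  refine volume_eq_zero_of_smul_sdiff_null h.ne_zero h.norm_lt_one
    (isCompact_frontier_window h.norm_lt_one A).isBounded ?_ ?_
  · filter_upwards [isOpen_interior.mem_nhds h.zero_mem_interior_window_A] with z hz hz'
    exact hz'.2 hz
  · have hnull := h.volume_image_frontier_sdiff (i := A) (j := A) (d := 0) (by decide)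
    simp only [map_zero, add_zero] at hnull
    exact hnull

theorem volume_frontier_window (h : IsRootPair α β) (i : Letter) :
    volume (frontier (window β i)) = 0 := by
  have hne (j : Letter) : volume (frontier (window β j)) ≠ ∞ :=
    (isCompact_frontier_window h.norm_lt_one j).measure_ne_top
  have hA : volume.real (frontier (window β A)) = 0 := by
    rw [measureReal_def, h.volume_frontier_window_A, ENNReal.toReal_zero]
  have hB : volume.real (frontier (window β B)) = 0 := by
    have hsum := (h.volumeReal_frontier_window A).symm.trans hA
    rw [mul_eq_zero_iff_left (pow_ne_zero 2 (norm_ne_zero_iff.2 h.ne_zero)),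
      Finset.sum_eq_zero_iff_of_nonneg fun _ _ => measureReal_nonneg] at hsum
    exact hsum (B, 0) (by decide)
  have hC : volume.real (frontier (window β C)) = 0 := by
    rw [h.volumeReal_frontier_window C, mul_eq_zero]
    exact Or.inr ((Finset.sum_singleton _ _).trans hA)
  refine (measureReal_eq_zero_iff (hne i)).1 ?_
  cases i <;> assumption

theorem volume_frontier_shiftedWindow (h : IsRootPair α β) (c : ℂ) :
    volume (frontier (shiftedWindow β c)) = 0 := by
  rw [frontier_shiftedWindow, image_add_left, measure_preimage_add]
  refine measure_mono_null ?_ (measure_iUnion_null h.volume_frontier_window)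
  simpa only [mem_univ, iUnion_true, totalWindow] using
    frontier_biUnion_subset finite_univ (window β)

theorem interior_shiftedWindow_nonempty (h : IsRootPair α β) (c : ℂ) :
    (interior (shiftedWindow β c)).Nonempty := by
  have h0 : 0 ∈ interior (totalWindow β) :=
    innerWindow_subset_interior_totalWindow β (mem_iUnion.2 ⟨A, h.zero_mem_interior_window_A⟩)
  exact ⟨c + 0, (Homeomorph.addLeft c).image_interior (totalWindow β) ▸ mem_image_of_mem _ h0⟩

theorem isGenericModelSet (h : IsRootPair α β) {c : ℂ} (hc : c ∈ genericShifts α β) :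
    IsGenericModelSet (lattice α β) (shiftedWindow β c) where
  scheme := h.isCutProjectScheme_lattice
  relativelyCompact := (isCompact_shiftedWindow h.norm_lt_one c).closure
  interior_nonempty := h.interior_shiftedWindow_nonempty c
  volume_frontier := h.volume_frontier_shiftedWindow c
  nonsingular := image_snd_lattice_inter_frontier_shiftedWindow h.norm_lt_one hc

theorem locallyIndistinguishable (h : IsRootPair α β) {c c' : ℂ} (hc : c ∈ genericShifts α β)
    (hc' : c' ∈ genericShifts α β) :
    LocallyIndistinguishable (modelSet (lattice α β) (shiftedWindow β c))
      (modelSet (lattice α β) (shiftedWindow β c')) :=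
  ⟨h.patchesOccur hc c', h.patchesOccur hc' c⟩

end IsRootPair

end Kol

theorem mainTheorem10 (α : ℝ) (hα : α ^ 3 - 2 * α ^ 2 - 1 = 0)
    (β : ℂ) (hβ : β ^ 3 - 2 * β ^ 2 - 1 = 0) (hβ_im : β.im ≠ 0) :
    Dense (Kol.genericShifts α β) ∧
    (∀ c ∈ Kol.genericShifts α β,
      Kol.Repetitive (Kol.modelSet (Kol.lattice α β) (Kol.shiftedWindow β c)) ∧
      Kol.IsGenericModelSet (Kol.lattice α β) (Kol.shiftedWindow β c)) ∧
    (∀ c ∈ Kol.genericShifts α β, ∀ c' ∈ Kol.genericShifts α β,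
      Kol.LocallyIndistinguishable
        (Kol.modelSet (Kol.lattice α β) (Kol.shiftedWindow β c))
        (Kol.modelSet (Kol.lattice α β) (Kol.shiftedWindow β c'))) ∧
    (∀ c ∈ Kol.genericShifts α β,
      Kol.LocallyIndistinguishable (Kol.sigmaKol α)
        (Kol.modelSet (Kol.lattice α β) (Kol.shiftedWindow β c))) := by
  have h : Kol.IsRootPair α β := ⟨hα, hβ, hβ_im⟩
  refine ⟨h.dense_genericShifts, fun c hc => ⟨h.repetitive hc, h.isGenericModelSet hc⟩,
    fun c hc c' hc' => h.locallyIndistinguishable hc hc', fun c hc => ?_⟩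
  rw [h.sigmaKol_eq_modelSet]
  exact h.locallyIndistinguishable h.zero_mem_genericShifts hc
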